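/- Let $d\ge 2$ and $0<\alpha_1<\alpha_2$. Let $a_0=0$ and $a_{k+1}=2^{a_k}$ for $k\ge 0$, and let $\nu$ be the probability law on $[0,\infty)$ whose density with respect to Lebesgue measure is $c_3e^{-\alpha_2x}$ on the intervals $[a_{2k},a_{2k+1})$, $k\ge 0$, and $c_3e^{-\alpha_1x}$ on the intervals $[a_{2k-1},a_{2k})$, $k\ge 1$, where $c_3>0$ is the normalising constant. Let $(\tau_e)$ be independent random variables with law $\nu$, indexed by the nearest-neighbour edges $e$ of $\mathbb Z^d$. For $x,y\in\mathbb R^d$ let $T(x,y)=\inf_\gamma\sum_{e\in\gamma}\tau_e$, the infimum being over all finite nearest-neighbour paths $\gamma$ from $\lfloor x\rfloor$ to $\lfloor y\rfloor$ (coordinatewise integer parts). Let $\mathbf e_1$ be the first standard basis vector and let $\mu=\lim_{t\to\infty}t^{-1}\mathbb E[T(0,t\mathbf e_1)]$ be the time constant. Then $\int e^{\rho x}\,\nu(dx)<\infty$ for every $\rho<\alpha_1$; the variables $T(0,t\mathbf e_1)$ are integrable and the limit defining $\mu$ exists and is finite; and for every $\xi>0$, $$\limsup_{n\to\infty}\frac1n\log\mathbb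 P\big(T(0,n\mathbf e_1)>n(\mu+\xi)\big)=-2d\alpha_1\xi,\qquad \liminf_{n\to\infty}\frac1n\log\mathbb P\big(T(0,n\mathbf e_1)>n(\mu+\xi)\big)=-2d\alpha_2\xi .$$ In particular $$-\infty<\liminf_{n\to\infty}\frac1n\log\mathbb P\big(T(0,n\mathbf e_1)>n(\mu+\xi)\big)<\limsup_{n\to\infty}\frac1n\log\mathbb P\big(T(0,n\mathbf e_1)>n(\mu+\xi)\big)<0,$$ so $\lim_{n\to\infty}\frac1n\log\mathbb P\big(T(0,n\mathbf e_1)>n(\mu+\xi)\big)$ does not exist, not even in $[-\infty,\infty]$. -/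

import Mathlib

open MeasureTheory ProbabilityTheory Filter Topology

noncomputable section

namespace FPP

/-- The nearest-neighbour graph on `ℤ^d`: `x` and `y` are adjacent iff `|x - y|₁ = 1`. -/
def lattice (d : ℕ) : SimpleGraph (Fin d → ℤ) where
  Adj x y := ∑ i, |x i - y i| = 1
  symm := ⟨fun x y h => by simpa only [abs_sub_comm] using h⟩
  loopless := ⟨fun x h => by simp at h⟩

/-- The (undirected) nearest-neighbour edges of `ℤ^d`. -/
abbrev Edge (d : ℕ) : Type := (lattice d).edgeSet

/-- Passage time `T(γ)` of a finite nearest-neighbour path: the sum of the weights along `γ`. -/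
def pathTime {d : ℕ} (t : Edge d → ℝ) : {x y : Fin d → ℤ} → (lattice d).Walk x y → ℝ
  | _, _, .nil => 0
  | _, _, .cons (u := x) (v := z) h p =>
      t ⟨s(x, z), (SimpleGraph.mem_edgeSet (lattice d)).2 h⟩ + pathTime t p

/-- Coordinatewise integer part `⌊x⌋` of a point of `ℝ^d`. -/
def floorPt {d : ℕ} (x : Fin d → ℝ) : Fin d → ℤ := fun i => ⌊x i⌋

/-- First passage time `T(x, y)`: the infimum of `T(γ)` over all finite nearest-neighbour
paths `γ` from `⌊x⌋` to `⌊y⌋`. -/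
def passageTime {d : ℕ} (t : Edge d → ℝ) (x y : Fin d → ℝ) : ℝ :=
  ⨅ γ : (lattice d).Walk (floorPt x) (floorPt y), pathTime t γ

/-- The first standard basis vector of `ℝ^d`. -/
def e₁ (d : ℕ) : Fin d → ℝ := fun i => if (i : ℕ) = 0 then 1 else 0

/-- The time constant `μ(x) = lim_{t → ∞} t⁻¹ E[T(0, t x)]`. -/
def timeConstant {d : ℕ} {Ω : Type*} [MeasurableSpace Ω] (P : Measure Ω)
    (τ : Edge d → Ω → ℝ) (x : Fin d → ℝ) : ℝ :=
  limUnder atTop (fun t : ℝ => t⁻¹ * ∫ ω, passageTime (fun e => τ e ω) 0 (t • x) ∂P)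

/-- The tower sequence `a₀ = 0`, `a_{n+1} = 2 ^ a_n`. -/
def tower : ℕ → ℕ
  | 0 => 0
  | n + 1 => 2 ^ tower n

open Classical in
/-- The unnormalised density: `exp (-α₂ x)` on the intervals `[a_{2n}, a_{2n+1})`,
`exp (-α₁ x)` on the intervals `[a_{2n+1}, a_{2n+2})`, and `0` on `(-∞, 0)`. -/
def rawDensity (α₁ α₂ x : ℝ) : ℝ :=
  if ∃ n : ℕ, (tower (2 * n) : ℝ) ≤ x ∧ x < tower (2 * n + 1) then Real.exp (-α₂ * x)
  else if ∃ n : ℕ, (tower (2 * n + 1) : ℝ) ≤ x ∧ x < tower (2 * n + 2) then Real.exp (-α₁ * x)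
  else 0

/-- The normalising constant `c₃`. -/
def normConst (α₁ α₂ : ℝ) : ℝ := (∫ x, rawDensity α₁ α₂ x)⁻¹

/-- The law with density `c₃ · rawDensity` with respect to Lebesgue measure. -/
def weightLaw (α₁ α₂ : ℝ) : Measure ℝ :=
  volume.withDensity (fun x => ENNReal.ofReal (normConst α₁ α₂ * rawDensity α₁ α₂ x))

/-- The sequence `(1/n) log P(T(0, n e₁) > n (μ(e₁) + ξ))`, in the extended reals
(with `log 0 = -∞`). -/
def logUpperTail {d : ℕ} {Ω : Type*} [MeasurableSpace Ω] (P : Measure Ω)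
    (τ : Edge d → Ω → ℝ) (ξ : ℝ) (n : ℕ) : EReal :=
  (((1 : ℝ) / n : ℝ) : EReal) *
    ENNReal.log (P {ω | (n : ℝ) * (timeConstant P τ (e₁ d) + ξ)
      < passageTime (fun e => τ e ω) 0 ((n : ℝ) • e₁ d)})

end FPP

end

/-!
The large deviation `T(0, n e₁) > n (μ + ξ)` is caused by the `2d` edges at one endpoint: all of
them must delay the path by about `n ξ`. A weight of order `n` costs `α₁` or `α₂` per unit of
time, depending on which of the two exponential regimes of the weight law contains the scale `n`.
Since `tower (k + 1) = 2 ^ tower k`, a regime that contains the scale `tower k ^ 2` contains every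
fixed multiple of it, and the weights below `tower k` are negligible there. So the rate `2 d α ξ`
oscillates between `α = α₁` and `α = α₂`. The cost per unit is expressed relative to a filter on
`ℕ` by `UpperCost` and `LowerCost`; the two bounds below hold along any such filter, and are
applied to all `n` and to the squares of the even or odd tower numbers.

Lower bound (`IIDWeights.le_upper_tail`). A walk that leaves the origin pays for an edge there,
and then at least the passage time in the configuration with the weights at the origin set to `0`.
The two contributions are independent, and by a second moment argument the latter exceeds `n (μ -
ε)` with probability bounded below (`IIDWeights.exists_prob_clearStar_ge`).

Upper bound (`IIDWeights.upper_tail_le`). Take `m` disjoint parallel tubes in direction `e₁`,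
started at points at bounded distance from the origin. Inside a tube, the crossing time is at most
a sum of blocks, each a minimum over finitely many walks with mean close to `n₀ μ`
(`IIDWeights.exists_finite_approx`); these are independent up to finitely many residue classes.
The average over the tubes then exceeds `n (μ + ε)` with probability at most `exp (-B n)`, where
`B` is as large as desired if `m` is large (`IIDWeights.tube_bound`). It remains to connect the
endpoints to the ends of a tube. Two points on a coordinate axis are joined by `2d` edge-disjoint
routes of bounded length (`exists_bonds_passage_le`), so `2d` times the total delay at both ends
is at most a sum of boundedly many distinct weights, and the exponential Markov inequality for
truncated weights (`IIDWeights.measure_sum_gt_le`) gives the rate `2 d β ξ`.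

Edges are labelled by pairs `(x, j)`, standing for the edge from `x` to `x + e_j`, and the weights
are replaced by their positive parts, which changes them on a null set only.
-/

noncomputable section

namespace FPP

variable {d : ℕ}

/-! ### Edges, walks and passage times -/

/-- Oriented labels for the edges of `ℤ^d`: the label `(x, j)` stands for the edge between `x` and
`x + e_j`. Every edge has exactly one label, and translations act on labels by moving `x`. -/
abbrev Bond (d : ℕ) : Type := (Fin d → ℤ) × Fin d

lemma lattice_adj_add_single (x : Fin d → ℤ) (j : Fin d) :
    (lattice d).Adj x (x + Pi.single j 1) := by
  change ∑ i, |x i - (x + Pi.single j 1 : Fin d → ℤ) i| = 1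
  rw [Finset.sum_eq_single j]
  · simp
  · intro i _ hi
    simp [hi]
  · simp

/-- The edge with label `b`. -/
def bondEdge (b : Bond d) : Edge d :=
  ⟨s(b.1, b.1 + Pi.single b.2 1),
    (SimpleGraph.mem_edgeSet (lattice d)).2 (lattice_adj_add_single b.1 b.2)⟩

lemma single_one_injective {j j' : Fin d} (h : (Pi.single j 1 : Fin d → ℤ) = Pi.single j' 1) :
    j = j' := by
  by_contra hne
  have := congrFun h j
  simp [hne] at this

lemma bondEdge_injective : Function.Injective (bondEdge (d := d)) := by
  rintro ⟨x, j⟩ ⟨x', j'⟩ h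
  have h' : s(x, x + Pi.single j 1) = s(x', x' + Pi.single j' 1) := congrArg Subtype.val h
  rw [Sym2.eq_iff] at h'
  rcases h' with ⟨rfl, h2⟩ | ⟨h1, h2⟩
  · have := single_one_injective (add_left_cancel h2)
    rw [this]
  · exfalso
    rw [h1, add_assoc] at h2
    have h3 := congrFun h2 j
    simp only [Pi.add_apply, Pi.single_eq_same] at h3
    have h4 : (0 : ℤ) ≤ (Pi.single j' 1 : Fin d → ℤ) j := by
      rw [Pi.single_apply]; split_ifs <;> norm_num
    omega

lemma exists_eq_add_single_of_adj {x y : Fin d → ℤ} (h : (lattice d).Adj x y) :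
    ∃ j, y = x + Pi.single j 1 ∨ x = y + Pi.single j 1 := by
  change ∑ i, |x i - y i| = 1 at h
  have hne : ∃ j, x j - y j ≠ 0 := by
    by_contra! hc
    simp [hc] at h
  obtain ⟨j, hj⟩ := hne
  have h1 := Finset.add_sum_erase Finset.univ (fun i => |x i - y i|) (Finset.mem_univ j)
  have h2 : 0 ≤ ∑ i ∈ Finset.univ.erase j, |x i - y i| := Finset.sum_nonneg fun i _ => abs_nonneg _
  have h3 : 1 ≤ |x j - y j| := Int.one_le_abs hj
  have h4 : ∑ i ∈ Finset.univ.erase j, |x i - y i| = 0 := by omega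
  have h5 : |x j - y j| = 1 := by omega
  have h6 : ∀ i, i ≠ j → x i = y i := by
    intro i hi
    have := (Finset.sum_eq_zero_iff_of_nonneg fun i _ => abs_nonneg _).1 h4 i
      (Finset.mem_erase.2 ⟨hi, Finset.mem_univ i⟩)
    rwa [abs_eq_zero, sub_eq_zero] at this
  refine ⟨j, ?_⟩
  rcases (abs_eq zero_le_one).1 h5 with h | h
  · right
    funext i
    by_cases hi : i = j
    · subst hi; simp; omega
    · simp [hi, h6 i hi]
  · left
    funext i
    by_cases hi : i = j
    · subst hi; simp; omega
    · simp [hi, h6 i hi]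

lemma bondEdge_surjective : Function.Surjective (bondEdge (d := d)) := by
  rintro ⟨e, he⟩
  induction e using Sym2.ind with
  | _ x y =>
    obtain ⟨j, h | h⟩ := exists_eq_add_single_of_adj ((SimpleGraph.mem_edgeSet _).1 he)
    · exact ⟨(x, j), Subtype.ext (by simp [bondEdge, h])⟩
    · exact ⟨(y, j), Subtype.ext (by simp only [bondEdge]; rw [← h, Sym2.eq_swap])⟩

/-- Every edge has exactly one label. -/
def bondEquiv : Bond d ≃ Edge d :=
  Equiv.ofBijective bondEdge ⟨bondEdge_injective, bondEdge_surjective⟩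

/-- The weight of an unordered pair of sites, `0` if the pair is not an edge. -/
def pairWeight (w : Bond d → ℝ) (e : Sym2 (Fin d → ℤ)) : ℝ :=
  open Classical in
  if h : e ∈ (lattice d).edgeSet then w (bondEquiv.symm ⟨e, h⟩) else 0

lemma pairWeight_bondEdge (w : Bond d → ℝ) (b : Bond d) : pairWeight w (bondEdge b) = w b := by
  have h : ((bondEdge b : Edge d) : Sym2 (Fin d → ℤ)) ∈ (lattice d).edgeSet := (bondEdge b).2
  rw [pairWeight, dif_pos h]
  congr 1
  rw [Equiv.symm_apply_eq]
  rfl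

/-- Passage time of a walk, for weights indexed by labels. -/
def walkTime (w : Bond d → ℝ) {x y : Fin d → ℤ} (γ : (lattice d).Walk x y) : ℝ :=
  pathTime (w ∘ bondEquiv.symm) γ

lemma walkTime_eq_sum (w : Bond d → ℝ) {x y : Fin d → ℤ} (γ : (lattice d).Walk x y) :
    walkTime w γ = (γ.edges.map (pairWeight w)).sum := by
  induction γ with
  | nil => simp [walkTime, pathTime]
  | @cons u v y h p ih =>
    have hm : s(u, v) ∈ (lattice d).edgeSet := (SimpleGraph.mem_edgeSet _).2 h
    rw [walkTime] at ih
    rw [walkTime, pathTime, ih, SimpleGraph.Walk.edges_cons, List.map_cons, List.sum_cons,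
      pairWeight, dif_pos hm]
    rfl

lemma pairWeight_nonneg {w : Bond d → ℝ} (hw : ∀ b, 0 ≤ w b) (e : Sym2 (Fin d → ℤ)) :
    0 ≤ pairWeight w e := by
  rw [pairWeight]; split_ifs
  · exact hw _
  · exact le_rfl

lemma walkTime_nonneg {w : Bond d → ℝ} (hw : ∀ b, 0 ≤ w b) {x y : Fin d → ℤ}
    (γ : (lattice d).Walk x y) : 0 ≤ walkTime w γ := by
  rw [walkTime_eq_sum]
  refine List.sum_nonneg fun a ha => ?_
  obtain ⟨e, -, rfl⟩ := List.mem_map.1 ha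
  exact pairWeight_nonneg hw e

/-- First passage time between lattice points, for weights indexed by labels. -/
def passage (w : Bond d → ℝ) (x y : Fin d → ℤ) : ℝ :=
  ⨅ γ : (lattice d).Walk x y, walkTime w γ

/-- The site `k e_j`. -/
abbrev axis (j : Fin d) (k : ℤ) : Fin d → ℤ := Pi.single j k

lemma axis_add (j : Fin d) (k l : ℤ) : axis j k + axis j l = axis j (k + l) :=
  (Pi.single_add (f := fun _ : Fin d => ℤ) j k l).symm

lemma passage_bddBelow {w : Bond d → ℝ} (hw : ∀ b, 0 ≤ w b) (x y : Fin d → ℤ) :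
    BddBelow (Set.range fun γ : (lattice d).Walk x y => walkTime w γ) :=
  ⟨0, by rintro _ ⟨γ, rfl⟩; exact walkTime_nonneg hw γ⟩

lemma passage_le_walkTime {w : Bond d → ℝ} (hw : ∀ b, 0 ≤ w b) {x y : Fin d → ℤ}
    (γ : (lattice d).Walk x y) : passage w x y ≤ walkTime w γ :=
  ciInf_le (passage_bddBelow hw x y) γ

lemma passage_nonneg {w : Bond d → ℝ} (hw : ∀ b, 0 ≤ w b) (x y : Fin d → ℤ) :
    0 ≤ passage w x y :=
  Real.iInf_nonneg fun γ => walkTime_nonneg hw γ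

/-- A walk of `k` steps in the positive direction `j`. -/
def straightWalk (x : Fin d → ℤ) (j : Fin d) : (k : ℕ) → (lattice d).Walk x (x + axis j k)
  | 0 => SimpleGraph.Walk.nil.copy rfl (by simp)
  | k + 1 => ((straightWalk x j k).append
      (SimpleGraph.Walk.cons (lattice_adj_add_single (x + axis j k) j) .nil)).copy rfl
      (by rw [add_assoc]; congr 1; push_cast; exact axis_add j k 1)

lemma edges_straightWalk (x : Fin d → ℤ) (j : Fin d) (k : ℕ) :
    (straightWalk x j k).edges
      = (List.range k).map fun i : ℕ => ((bondEdge (x + axis j (i : ℤ), j) : Edge d) : Sym2 _) := by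
  induction k with
  | zero => simp [straightWalk]
  | succ k ih =>
    rw [straightWalk, SimpleGraph.Walk.edges_copy, SimpleGraph.Walk.edges_append, ih,
      List.range_succ]
    simp [bondEdge]

lemma walkTime_straightWalk (w : Bond d → ℝ) (x : Fin d → ℤ) (j : Fin d) (k : ℕ) :
    walkTime w (straightWalk x j k) = ∑ i ∈ Finset.range k, w (x + axis j i, j) := by
  rw [walkTime_eq_sum, edges_straightWalk, List.map_map]
  induction k with
  | zero => simp
  | succ k ih =>
    rw [List.range_succ, List.map_append, List.sum_append, ih, Finset.sum_range_succ]
    simp [pairWeight_bondEdge]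

lemma lattice_reachable (x y : Fin d → ℤ) : Nonempty ((lattice d).Walk x y) := by
  -- sites joined to `x` are closed under steps in every direction
  have step : ∀ (j : Fin d) (k : ℤ) (z : Fin d → ℤ), (lattice d).Reachable z (z + axis j k) := by
    intro j k z
    obtain ⟨n, rfl | rfl⟩ := Int.eq_nat_or_neg k
    · exact ⟨straightWalk z j n⟩
    · have h : (lattice d).Reachable (z + axis j (-n)) (z + axis j (-n) + axis j n) :=
        ⟨straightWalk _ j n⟩
      rw [add_assoc, axis_add] at h
      simpa using h.symm
  have key : ∀ s : Finset (Fin d), (lattice d).Reachable x (x + ∑ j ∈ s, axis j (y j - x j)) := by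
    intro s
    induction s using Finset.induction_on with
    | empty => simp
    | insert j s hj ih =>
      rw [Finset.sum_insert hj, add_comm (axis j _), ← add_assoc]
      exact ih.trans (step j _ _)
  have h := key Finset.univ
  have e : x + ∑ j, axis j (y j - x j) = y := by
    funext i
    rw [Pi.add_apply, Finset.sum_apply, Finset.sum_eq_single i]
    · simp
    · intro j _ hj
      simp [hj.symm]
    · simp
  rw [e] at h
  exact h

lemma le_passage {w : Bond d → ℝ} {x y : Fin d → ℤ} {c : ℝ}
    (h : ∀ γ : (lattice d).Walk x y, c ≤ walkTime w γ) : c ≤ passage w x y :=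
  haveI := lattice_reachable x y
  le_ciInf h

lemma passage_self {w : Bond d → ℝ} (hw : ∀ b, 0 ≤ w b) (x : Fin d → ℤ) : passage w x x = 0 :=
  le_antisymm ((passage_le_walkTime hw .nil).trans_eq (by simp [walkTime_eq_sum]))
    (passage_nonneg hw x x)

lemma passage_symm_le {w : Bond d → ℝ} (hw : ∀ b, 0 ≤ w b) (x y : Fin d → ℤ) :
    passage w x y ≤ passage w y x :=
  le_passage fun γ => (passage_le_walkTime hw γ.reverse).trans_eq (by
    rw [walkTime_eq_sum, walkTime_eq_sum, SimpleGraph.Walk.edges_reverse, List.map_reverse,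
      List.sum_reverse])

lemma passage_comm {w : Bond d → ℝ} (hw : ∀ b, 0 ≤ w b) (x y : Fin d → ℤ) :
    passage w x y = passage w y x :=
  le_antisymm (passage_symm_le hw x y) (passage_symm_le hw y x)

lemma passage_triangle {w : Bond d → ℝ} (hw : ∀ b, 0 ≤ w b) (x y z : Fin d → ℤ) :
    passage w x z ≤ passage w x y + passage w y z := by
  rw [← sub_le_iff_le_add']
  refine le_passage fun γ' => ?_
  rw [sub_le_comm]
  refine le_passage fun γ => ?_
  rw [sub_le_iff_le_add]
  refine (passage_le_walkTime hw (γ.append γ')).trans_eq ?_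
  simp [walkTime_eq_sum, SimpleGraph.Walk.edges_append]

lemma passage_le_straight {w : Bond d → ℝ} (hw : ∀ b, 0 ≤ w b) (x : Fin d → ℤ) (j : Fin d)
    (k : ℕ) : passage w x (x + axis j k) ≤ ∑ i ∈ Finset.range k, w (x + axis j i, j) :=
  (passage_le_walkTime hw (straightWalk x j k)).trans_eq (walkTime_straightWalk w x j k)

/-- Weights seen from the site `z`. -/
def shift (z : Fin d → ℤ) (w : Bond d → ℝ) : Bond d → ℝ := fun b => w (b.1 + z, b.2)

/-- Translation by `z`, as a graph homomorphism. -/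
def translate (z : Fin d → ℤ) : lattice d →g lattice d where
  toFun x := x + z
  map_rel' {x y} h := by
    change ∑ i, |(x + z) i - (y + z) i| = 1
    have h : ∑ i, |x i - y i| = 1 := h
    simpa using h

lemma pairWeight_shift (w : Bond d → ℝ) (z : Fin d → ℤ) {e : Sym2 (Fin d → ℤ)}
    (he : e ∈ (lattice d).edgeSet) :
    pairWeight w (e.map (translate z)) = pairWeight (shift z w) e := by
  obtain ⟨⟨x, j⟩, hb⟩ := bondEdge_surjective ⟨e, he⟩
  have he' : e = (bondEdge (x, j) : Edge d) := by rw [hb]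
  have h2 : e.map (translate z) = (bondEdge (x + z, j) : Edge d) := by
    rw [he']
    simp only [bondEdge, Sym2.map_mk]
    congr 2
    change x + Pi.single j 1 + z = x + z + Pi.single j 1
    abel
  rw [h2, he', pairWeight_bondEdge, pairWeight_bondEdge, shift]

lemma walkTime_map_translate (w : Bond d → ℝ) (z : Fin d → ℤ) {x y : Fin d → ℤ}
    (γ : (lattice d).Walk x y) :
    walkTime w (γ.map (translate z)) = walkTime (shift z w) γ := by
  rw [walkTime_eq_sum, walkTime_eq_sum, SimpleGraph.Walk.edges_map, List.map_map]
  congr 1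
  refine List.map_congr_left fun e he => ?_
  exact pairWeight_shift w z (SimpleGraph.Walk.edges_subset_edgeSet γ he)

lemma passage_shift {w : Bond d → ℝ} (hw : ∀ b, 0 ≤ w b) (z x y : Fin d → ℤ) :
    passage (shift z w) x y = passage w (x + z) (y + z) := by
  have key : ∀ (w : Bond d → ℝ), (∀ b, 0 ≤ w b) → ∀ z x y : Fin d → ℤ,
      passage w (x + z) (y + z) ≤ passage (shift z w) x y := fun w hw z x y =>
    le_passage fun γ => (passage_le_walkTime hw (γ.map (translate z))).trans_eq
      (walkTime_map_translate w z γ)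
  refine le_antisymm ?_ (key w hw z x y)
  have h := key (shift z w) (fun b => hw _) (-z) (x + z) (y + z)
  have h0 : shift (-z) (shift z w) = w := by
    funext b; simp [shift]
  rw [h0, add_neg_cancel_right, add_neg_cancel_right] at h
  exact h

/-- Loop erasure: a walk only pays once for each of the edges it uses. -/
lemma exists_bonds_of_walk {x y : Fin d → ℤ} (γ : (lattice d).Walk x y) :
    ∃ A : Finset (Bond d), (∀ b ∈ A, ((bondEdge b : Edge d) : Sym2 _) ∈ γ.edges) ∧
      ∀ w : Bond d → ℝ, (∀ b, 0 ≤ w b) →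
        passage w x y ≤ ∑ b ∈ A, w b ∧ ∑ b ∈ A, w b ≤ walkTime w γ := by
  classical
  have hsub := γ.edges_bypass_subset_edges
  have hnd : γ.bypass.edges.Nodup := (γ.bypass_isPath).isTrail.edges_nodup
  set A : Finset (Bond d) := γ.bypass.edges.toFinset.preimage
    (fun b => ((bondEdge b : Edge d) : Sym2 _))
    (Subtype.val_injective.comp bondEdge_injective).injOn with hA
  have hsum : ∀ w : Bond d → ℝ, ∑ b ∈ A, w b = walkTime w γ.bypass := by
    intro w
    rw [walkTime_eq_sum, ← List.sum_toFinset _ hnd, hA,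
      ← Finset.sum_preimage (fun b => ((bondEdge b : Edge d) : Sym2 (Fin d → ℤ))) _
        (Subtype.val_injective.comp bondEdge_injective).injOn (pairWeight w)]
    · simp [pairWeight_bondEdge]
    · intro e he hne
      exfalso
      apply hne
      rw [List.mem_toFinset] at he
      obtain ⟨b, hb⟩ := bondEdge_surjective ⟨e, SimpleGraph.Walk.edges_subset_edgeSet _ he⟩
      exact ⟨b, by simp [hb]⟩
  refine ⟨A, fun b hb => ?_, fun w hw => ⟨?_, ?_⟩⟩
  · rw [hA, Finset.mem_preimage, List.mem_toFinset] at hb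
    exact hsub hb
  · rw [hsum]
    exact passage_le_walkTime hw _
  · have hmul : ∀ (l l' : List (Sym2 (Fin d → ℤ))), l.Nodup → l ⊆ l' →
        (l.map (pairWeight w)).sum ≤ (l'.map (pairWeight w)).sum := by
      intro l l' hl hsub
      obtain ⟨l'', hp, hs⟩ := hl.subperm hsub
      rw [← (hp.map (pairWeight w)).sum_eq]
      refine (hs.map (pairWeight w)).sum_le_sum fun a ha => ?_
      obtain ⟨e, -, rfl⟩ := List.mem_map.1 ha
      exact pairWeight_nonneg hw e
    rw [hsum, walkTime_eq_sum, walkTime_eq_sum]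
    exact hmul _ _ hnd hsub

/-! ### Edge-disjoint routes and the edges at the origin -/

/-- `x` and `y` are joined by a walk all of whose edges have labels in `A`. -/
def JoinedIn (A : Finset (Bond d)) (x y : Fin d → ℤ) : Prop :=
  ∃ γ : (lattice d).Walk x y, ∀ e ∈ γ.edges, ∃ b ∈ A, e = (bondEdge b : Edge d)

lemma JoinedIn.symm {A : Finset (Bond d)} {x y : Fin d → ℤ} (h : JoinedIn A x y) :
    JoinedIn A y x := by
  obtain ⟨γ, hγ⟩ := h
  exact ⟨γ.reverse, fun e he => hγ e (by simpa using he)⟩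

lemma JoinedIn.trans {A : Finset (Bond d)} {x y z : Fin d → ℤ} (h : JoinedIn A x y)
    (h' : JoinedIn A y z) : JoinedIn A x z := by
  obtain ⟨γ, hγ⟩ := h
  obtain ⟨γ', hγ'⟩ := h'
  refine ⟨γ.append γ', fun e he => ?_⟩
  rw [SimpleGraph.Walk.edges_append, List.mem_append] at he
  exact he.elim (hγ e) (hγ' e)

lemma JoinedIn.straight {A : Finset (Bond d)} {x y : Fin d → ℤ} (j : Fin d) (k : ℕ)
    (hy : y = x + axis j k) (h : ∀ i < k, (x + axis j (i : ℤ), j) ∈ A) : JoinedIn A x y := by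
  subst hy
  refine ⟨straightWalk x j k, fun e he => ?_⟩
  rw [edges_straightWalk] at he
  obtain ⟨i, hi, rfl⟩ := List.mem_map.1 he
  exact ⟨_, h i (List.mem_range.1 hi), rfl⟩

lemma JoinedIn.passage_le {A : Finset (Bond d)} {x y : Fin d → ℤ} (h : JoinedIn A x y)
    {w : Bond d → ℝ} (hw : ∀ b, 0 ≤ w b) : passage w x y ≤ ∑ b ∈ A, w b := by
  obtain ⟨γ, hγ⟩ := h
  obtain ⟨B, hB, hs⟩ := exists_bonds_of_walk γ
  refine (hs w hw).1.trans (Finset.sum_le_sum_of_subset_of_nonneg (fun b hb => ?_)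
    fun b _ _ => hw b)
  obtain ⟨b', hb', he⟩ := hγ _ (hB b hb)
  rwa [bondEdge_injective (Subtype.ext he)]

/-- The labels on the route number `l` from `0` to `k e_{i₁}`. The route `(j, ±)` with `j ≠ i₁`
leaves `0` in the direction `± e_j`, goes `k` steps in direction `i₁` and comes back; the route
`(i₁, +)` is the segment; the route `(i₁, -)` leaves `0` in the direction `- e_{i₁}`, moves two
steps in direction `i₀`, passes beyond the target and enters it from the far side. -/
def OnRoute (i₀ i₁ : Fin d) (k : ℕ) (l : Fin d × Bool) (b : Bond d) : Prop :=
  (l.1 ≠ i₁ ∧ b.2 = l.1 ∧ (b.1 i₁ = 0 ∨ b.1 i₁ = k) ∧ b.1 l.1 = if l.2 then 0 else -1) ∨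
  (l.1 ≠ i₁ ∧ b.2 = i₁ ∧ (b.1 l.1 = if l.2 then 1 else -1) ∧
    ∀ i, i ≠ i₁ → i ≠ l.1 → b.1 i = 0) ∨
  (l.1 = i₁ ∧ l.2 = true ∧ b.2 = i₁ ∧ 0 ≤ b.1 i₁ ∧ b.1 i₁ < k ∧ ∀ i, i ≠ i₁ → b.1 i = 0) ∨
  (l.1 = i₁ ∧ l.2 = false ∧ b.2 = i₀ ∧ (b.1 i₁ = -1 ∨ b.1 i₁ = k + 1)) ∨
  (l.1 = i₁ ∧ l.2 = false ∧ b.2 = i₁ ∧ b.1 i₀ = 2) ∨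
  (l.1 = i₁ ∧ l.2 = false ∧ b.2 = i₁ ∧ (b.1 i₁ = -1 ∨ b.1 i₁ = k) ∧ ∀ i, i ≠ i₁ → b.1 i = 0)

lemma OnRoute.unique {i₀ i₁ : Fin d} (h01 : i₀ ≠ i₁) {k : ℕ} {l l' : Fin d × Bool} {b : Bond d}
    (h : OnRoute i₀ i₁ k l b) (h' : OnRoute i₀ i₁ k l' b) : l = l' := by
  obtain ⟨j, σ⟩ := l
  obtain ⟨j', σ'⟩ := l'
  obtain ⟨x, i⟩ := b
  simp only [OnRoute] at h h'
  have hb : ∀ σ : Bool, σ = true ∨ σ = false := by decide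
  rcases h with ⟨h1, h2, h3, h4⟩ | ⟨h1, h2, h3, h4⟩ | ⟨h1, h2, h3, h4, h5, h6⟩ | ⟨h1, h2, h3, h4⟩ |
    ⟨h1, h2, h3, h4⟩ | ⟨h1, h2, h3, h4, h5⟩ <;>
  rcases h' with ⟨g1, g2, g3, g4⟩ | ⟨g1, g2, g3, g4⟩ | ⟨g1, g2, g3, g4, g5, g6⟩ |
    ⟨g1, g2, g3, g4⟩ | ⟨g1, g2, g3, g4⟩ | ⟨g1, g2, g3, g4, g5⟩ <;>
  rcases hb σ with rfl | rfl <;> rcases hb σ' with rfl | rfl <;> grind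

/-- Between `0` and `k e_{i₁}` there are `2d` edge-disjoint routes, so `2d` times the passage
time is at most a sum of weights in which every edge occurs once. -/
lemma exists_bonds_passage_le (i₀ i₁ : Fin d) (h01 : i₀ ≠ i₁) (k : ℕ) :
    ∃ F : Finset (Bond d), ∀ w : Bond d → ℝ, (∀ b, 0 ≤ w b) →
      2 * d * passage w 0 (axis i₁ k) ≤ ∑ b ∈ F, w b := by
  classical
  set box : Finset (Bond d) :=
    Finset.Icc (fun _ => (-1 : ℤ)) (fun _ => (k : ℤ) + 2) ×ˢ Finset.univ with hbox
  set A : Fin d × Bool → Finset (Bond d) := fun l => box.filter (OnRoute i₀ i₁ k l) with hA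
  have hmem : ∀ l x i, (∀ i', -1 ≤ x i' ∧ x i' ≤ (k : ℤ) + 2) → OnRoute i₀ i₁ k l (x, i) →
      (x, i) ∈ A l := by
    intro l x i hx h
    simp only [hA, hbox, Finset.mem_filter, Finset.mem_product, Finset.mem_Icc, Finset.mem_univ,
      and_true]
    exact ⟨⟨fun i' => (hx i').1, fun i' => (hx i').2⟩, h⟩
  have hjoin : ∀ l, JoinedIn (A l) 0 (axis i₁ k) := by
    rintro ⟨j, σ⟩
    by_cases hj : j = i₁
    · subst hj
      cases σ with
      | true =>
        refine JoinedIn.straight j k (by simp) fun i hi => hmem _ _ _ ?_ ?_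
        · intro i'
          by_cases h : i' = j
          · subst h; simp; omega
          · simp [h]; omega
        · refine Or.inr (Or.inr (Or.inl ?_))
          simp +contextual [hi]
      | false =>
        have hb : JoinedIn (A (j, false)) (-axis j 1) 0 := by
          refine JoinedIn.straight j 1 (by simp) fun i hi => hmem _ _ _ ?_ ?_
          · intro i'
            by_cases h : i' = j
            · subst h; simp; omega
            · simp [h]; omega
          · refine Or.inr (Or.inr (Or.inr (Or.inr (Or.inr ?_))))
            obtain rfl : i = 0 := by omega
            simp +contextual
        have he : JoinedIn (A (j, false)) (axis j k) (axis j (k + 1)) := by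
          refine JoinedIn.straight j 1 (by rw [axis_add]; simp) fun i hi => hmem _ _ _ ?_ ?_
          · intro i'
            by_cases h : i' = j
            · subst h; simp; omega
            · simp [h]; omega
          · refine Or.inr (Or.inr (Or.inr (Or.inr (Or.inr ?_))))
            obtain rfl : i = 0 := by omega
            simp +contextual
        have hb' : JoinedIn (A (j, false)) (-axis j 1) (-axis j 1 + axis i₀ 2) := by
          refine JoinedIn.straight i₀ 2 rfl fun i hi => hmem _ _ _ ?_ ?_
          · intro i'
            by_cases h : i' = j
            · subst h; simp [h01.symm]; omega
            · by_cases h' : i' = i₀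
              · subst h'; simp [h01]; omega
              · simp [h, h']; omega
          · refine Or.inr (Or.inr (Or.inr (Or.inl ?_)))
            simp [h01.symm]
        have he' : JoinedIn (A (j, false)) (axis j (k + 1)) (axis j (k + 1) + axis i₀ 2) := by
          refine JoinedIn.straight i₀ 2 rfl fun i hi => hmem _ _ _ ?_ ?_
          · intro i'
            by_cases h : i' = j
            · subst h; simp [h01.symm]; omega
            · by_cases h' : i' = i₀
              · subst h'; simp [h01]; omega
              · simp [h, h']; omega
          · refine Or.inr (Or.inr (Or.inr (Or.inl ?_)))
            simp [h01.symm]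
        have hm : JoinedIn (A (j, false)) (-axis j 1 + axis i₀ 2) (axis j (k + 1) + axis i₀ 2) := by
          refine JoinedIn.straight j (k + 2) ?_ fun i hi => hmem _ _ _ ?_ ?_
          · funext i'
            by_cases h : i' = j
            · subst h; simp [h01.symm]; ring
            · simp [h]
          · intro i'
            by_cases h : i' = j
            · subst h; simp [h01.symm]; omega
            · by_cases h' : i' = i₀
              · subst h'; simp [h01]
              · simp [h, h']; omega
          · refine Or.inr (Or.inr (Or.inr (Or.inr (Or.inl ?_))))
            simp [h01]
        exact hb.symm.trans (hb'.trans (hm.trans (he'.symm.trans he.symm)))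
    · cases σ with
      | true =>
        have h1 : JoinedIn (A (j, true)) 0 (axis j 1) := by
          refine JoinedIn.straight j 1 (by simp) fun i hi => hmem _ _ _ ?_ ?_
          · obtain rfl : i = 0 := by omega
            intro i'; simp; omega
          · obtain rfl : i = 0 := by omega
            exact Or.inl (by simp [hj])
        have h2 : JoinedIn (A (j, true)) (axis i₁ k) (axis i₁ k + axis j 1) := by
          refine JoinedIn.straight j 1 (by simp) fun i hi => hmem _ _ _ ?_ ?_
          · obtain rfl : i = 0 := by omega
            intro i'
            by_cases h : i' = i₁
            · subst h; simp
            · simp [h]; omega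
          · obtain rfl : i = 0 := by omega
            exact Or.inl (by simp [hj])
        have h3 : JoinedIn (A (j, true)) (axis j 1) (axis i₁ k + axis j 1) := by
          refine JoinedIn.straight i₁ k (add_comm _ _) fun i hi => hmem _ _ _ ?_ ?_
          · intro i'
            by_cases h : i' = i₁
            · subst h; simp [Ne.symm hj]; omega
            · by_cases h' : i' = j
              · subst h'; simp [h]; omega
              · simp [h, h']; omega
          · refine Or.inr (Or.inl ?_)
            simp +contextual [hj]
        exact h1.trans (h3.trans h2.symm)
      | false =>
        have h1 : JoinedIn (A (j, false)) (-axis j 1) 0 := by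
          refine JoinedIn.straight j 1 (by simp) fun i hi => hmem _ _ _ ?_ ?_
          · obtain rfl : i = 0 := by omega
            intro i'
            by_cases h : i' = j
            · subst h; simp; omega
            · simp [h]; omega
          · obtain rfl : i = 0 := by omega
            exact Or.inl (by simp [hj, Ne.symm hj])
        have h2 : JoinedIn (A (j, false)) (axis i₁ k - axis j 1) (axis i₁ k) := by
          refine JoinedIn.straight j 1 (by simp) fun i hi => hmem _ _ _ ?_ ?_
          · obtain rfl : i = 0 := by omega
            intro i'
            by_cases h : i' = i₁
            · subst h; simp [Ne.symm hj]
            · by_cases h' : i' = j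
              · subst h'; simp [h]; omega
              · simp [h, h']; omega
          · obtain rfl : i = 0 := by omega
            exact Or.inl (by simp [hj, Ne.symm hj])
        have h3 : JoinedIn (A (j, false)) (-axis j 1) (axis i₁ k - axis j 1) := by
          refine JoinedIn.straight i₁ k (by abel) fun i hi => hmem _ _ _ ?_ ?_
          · intro i'
            by_cases h : i' = i₁
            · subst h; simp [Ne.symm hj]; omega
            · by_cases h' : i' = j
              · subst h'; simp [h]; omega
              · simp [h, h']; omega
          · refine Or.inr (Or.inl ?_)
            simp +contextual [hj]
        exact h1.symm.trans (h3.trans h2)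
  refine ⟨Finset.univ.biUnion A, fun w hw => ?_⟩
  rw [Finset.sum_biUnion]
  · calc 2 * d * passage w 0 (axis i₁ k) = ∑ _l : Fin d × Bool, passage w 0 (axis i₁ k) := by
          rw [Finset.sum_const, Finset.card_univ, Fintype.card_prod, Fintype.card_fin,
            Fintype.card_bool, nsmul_eq_mul]
          push_cast; ring
      _ ≤ _ := Finset.sum_le_sum fun l _ => (hjoin l).passage_le hw
  · intro l _ l' _ hne
    rw [Function.onFun, Finset.disjoint_left]
    intro b hb hb'
    exact hne (OnRoute.unique h01 (Finset.mem_filter.1 hb).2 (Finset.mem_filter.1 hb').2)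

/-- The labels of the `2d` edges at the origin. -/
def star (d : ℕ) : Finset (Bond d) :=
  Finset.univ.image (fun j : Fin d => ((0 : Fin d → ℤ), j)) ∪
    Finset.univ.image (fun j : Fin d => (-axis j 1, j))

lemma card_star (d : ℕ) : (star d).card = 2 * d := by
  rw [star, Finset.card_union_of_disjoint, Finset.card_image_of_injective,
    Finset.card_image_of_injective]
  · simp; ring
  · intro j j' h; exact (Prod.ext_iff.1 h).2
  · intro j j' h; exact (Prod.ext_iff.1 h).2
  · rw [Finset.disjoint_left]
    intro b hb hb'
    obtain ⟨j, -, rfl⟩ := Finset.mem_image.1 hb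
    obtain ⟨j', -, h⟩ := Finset.mem_image.1 hb'
    have := congrFun (Prod.ext_iff.1 h).1 j'
    simp at this

/-- The weights with those at the origin replaced by `0`. -/
def clearStar (w : Bond d → ℝ) : Bond d → ℝ := fun b => if b ∈ star d then 0 else w b

lemma clearStar_nonneg {w : Bond d → ℝ} (hw : ∀ b, 0 ≤ w b) (b : Bond d) : 0 ≤ clearStar w b := by
  rw [clearStar]; split_ifs
  · exact le_rfl
  · exact hw b

lemma clearStar_le {w : Bond d → ℝ} (hw : ∀ b, 0 ≤ w b) (b : Bond d) : clearStar w b ≤ w b := by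
  rw [clearStar]; split_ifs
  · exact hw b
  · exact le_rfl

lemma pairWeight_mono {w w' : Bond d → ℝ} (h : ∀ b, w b ≤ w' b) (e : Sym2 (Fin d → ℤ)) :
    pairWeight w e ≤ pairWeight w' e := by
  rw [pairWeight, pairWeight]; split_ifs
  · exact h _
  · exact le_rfl

lemma walkTime_mono {w w' : Bond d → ℝ} (h : ∀ b, w b ≤ w' b) {x y : Fin d → ℤ}
    (γ : (lattice d).Walk x y) : walkTime w γ ≤ walkTime w' γ := by
  rw [walkTime_eq_sum, walkTime_eq_sum]
  exact List.sum_le_sum fun e _ => pairWeight_mono h e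

lemma passage_mono {w w' : Bond d → ℝ} (hw : ∀ b, 0 ≤ w b) (h : ∀ b, w b ≤ w' b)
    (x y : Fin d → ℤ) : passage w x y ≤ passage w' x y :=
  le_passage fun γ => (passage_le_walkTime hw γ).trans (walkTime_mono h γ)

/-- A walk from the origin pays for an edge at the origin. -/
lemma add_passage_clearStar_le {w : Bond d → ℝ} (hw : ∀ b, 0 ≤ w b) {c : ℝ}
    (hc : ∀ b ∈ star d, c ≤ w b) {y : Fin d → ℤ} (hy : y ≠ 0) :
    c + passage (clearStar w) 0 y ≤ passage w 0 y := by
  refine le_passage fun γ => ?_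
  refine le_trans (add_le_add_right (passage_le_walkTime (clearStar_nonneg hw) γ) c) ?_
  cases γ with
  | nil => exact absurd rfl hy
  | @cons _ z _ h p =>
    have hb : ∃ b ∈ star d, s(0, z) = ((bondEdge b : Edge d) : Sym2 (Fin d → ℤ)) := by
      obtain ⟨j, hj | hj⟩ := exists_eq_add_single_of_adj h
      · exact ⟨(0, j), by simp [star], by simp [bondEdge, hj]⟩
      · obtain rfl : z = -axis j 1 := by rw [eq_neg_iff_add_eq_zero]; exact hj.symm
        exact ⟨(-axis j 1, j), by simp [star], by simp [bondEdge, Sym2.eq_swap]⟩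
    obtain ⟨b, hb, he⟩ := hb
    have h1 := walkTime_mono (clearStar_le hw) p
    rw [walkTime_eq_sum, walkTime_eq_sum] at h1 ⊢
    simp only [SimpleGraph.Walk.edges_cons, List.map_cons, List.sum_cons, he, pairWeight_bondEdge]
    have h2 : clearStar w b = 0 := if_pos hb
    linarith [hc b hb]

/-- A loop-free walk uses each edge at the origin at most once. -/
lemma passage_le_clearStar_add {w : Bond d → ℝ} (hw : ∀ b, 0 ≤ w b) (y : Fin d → ℤ) :
    passage w 0 y ≤ passage (clearStar w) 0 y + ∑ b ∈ star d, w b := by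
  classical
  rw [← sub_le_iff_le_add]
  refine le_passage fun γ => ?_
  rw [sub_le_iff_le_add]
  obtain ⟨A, -, hA⟩ := exists_bonds_of_walk γ
  refine (hA w hw).1.trans (le_trans ?_
    (add_le_add_left (hA _ (clearStar_nonneg hw)).2 _))
  have h1 : ∑ b ∈ A, w b = ∑ b ∈ A, clearStar w b + ∑ b ∈ A, if b ∈ star d then w b else 0 := by
    rw [← Finset.sum_add_distrib]
    refine Finset.sum_congr rfl fun b _ => ?_
    rw [clearStar]; split_ifs <;> simp
  rw [h1, ← Finset.sum_filter]
  refine add_le_add_right (Finset.sum_le_sum_of_subset_of_nonneg ?_ fun b _ _ => hw b) _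
  intro b hb
  exact (Finset.mem_filter.1 hb).2

/-! ### Independent weights: stationarity, the rate, finite approximations -/

variable {Ω : Type*} [MeasurableSpace Ω] {P : Measure Ω} {τ : Bond d → Ω → ℝ}
  {ν : Measure ℝ} {ρ₀ : ℝ}

instance countable_walk (x y : Fin d → ℤ) : Countable ((lattice d).Walk x y) :=
  (SimpleGraph.Walk.support_injective (G := lattice d) (u := x) (v := y)).countable

/-- The labels of the edges of a walk. -/
def walkBonds {x y : Fin d → ℤ} (γ : (lattice d).Walk x y) : Finset (Bond d) :=
  γ.edges.toFinset.preimage (fun b => ((bondEdge b : Edge d) : Sym2 _))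
    (Subtype.val_injective.comp bondEdge_injective).injOn

lemma walkTime_congr {x y : Fin d → ℤ} (γ : (lattice d).Walk x y) {w w' : Bond d → ℝ}
    (h : ∀ b ∈ walkBonds γ, w b = w' b) : walkTime w γ = walkTime w' γ := by
  rw [walkTime_eq_sum, walkTime_eq_sum]
  congr 1
  refine List.map_congr_left fun e he => ?_
  obtain ⟨b, hb⟩ := bondEdge_surjective ⟨e, SimpleGraph.Walk.edges_subset_edgeSet _ he⟩
  have hb' : e = (bondEdge b : Edge d) := by rw [hb]
  rw [hb', pairWeight_bondEdge, pairWeight_bondEdge]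
  refine h b ?_
  rw [walkBonds, Finset.mem_preimage, List.mem_toFinset]
  rwa [← hb']

lemma measurable_walkTime {x y : Fin d → ℤ} (γ : (lattice d).Walk x y) :
    Measurable fun w : Bond d → ℝ => walkTime w γ := by
  simp only [walkTime_eq_sum]
  induction γ.edges with
  | nil => simp
  | cons e l ih =>
    simp only [List.map_cons, List.sum_cons]
    refine Measurable.add ?_ ih
    simp only [pairWeight]
    split_ifs
    · exact measurable_pi_apply _
    · exact measurable_const

lemma measurable_passage (x y : Fin d → ℤ) :
    Measurable fun w : Bond d → ℝ => passage w x y :=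
  Measurable.iInf fun γ => measurable_walkTime γ

/-- Independent nonnegative edge weights with law `ν`, where `ν` has a finite exponential moment of
order `ρ₀ > 0`. -/
structure IIDWeights (P : Measure Ω) (τ : Bond d → Ω → ℝ) (ν : Measure ℝ) (ρ₀ : ℝ) : Prop where
  meas : ∀ b, Measurable (τ b)
  indep : iIndepFun τ P
  law : ∀ b, P.map (τ b) = ν
  nonneg : ∀ b ω, 0 ≤ τ b ω
  rate_pos : 0 < ρ₀
  exp_int : Integrable (fun x => Real.exp (ρ₀ * x)) ν

/-- The weight configuration of the sample `ω`. -/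
def config (τ : Bond d → Ω → ℝ) (ω : Ω) : Bond d → ℝ := fun b => τ b ω

namespace IIDWeights

lemma measurable_config (h : IIDWeights P τ ν ρ₀) : Measurable (config τ) :=
  measurable_pi_lambda _ h.meas

lemma config_nonneg (h : IIDWeights P τ ν ρ₀) (ω : Ω) (b : Bond d) : 0 ≤ config τ ω b :=
  h.nonneg b ω

/-- Independent identically distributed weights are stationary under translations. -/
lemma identDistrib_shift [IsProbabilityMeasure P] (h : IIDWeights P τ ν ρ₀) (z : Fin d → ℤ) :
    IdentDistrib (fun ω => shift z (config τ ω)) (config τ) P P := by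
  have hinj : Function.Injective fun b : Bond d => ((b.1 + z, b.2) : Bond d) := by
    rintro ⟨x, i⟩ ⟨y, j⟩ hxy
    simp only [Prod.mk.injEq, add_left_inj] at hxy
    exact Prod.ext hxy.1 hxy.2
  exact IdentDistrib.pi (X := fun b ω => τ (b.1 + z, b.2) ω) (Y := τ)
    (fun b => ⟨(h.meas _).aemeasurable, (h.meas _).aemeasurable, by rw [h.law, h.law]⟩)
    (h.indep.precomp hinj) h.indep

lemma integrable_comp (h : IIDWeights P τ ν ρ₀) (b : Bond d) {f : ℝ → ℝ} (hf : Integrable f ν) :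
    Integrable (fun ω => f (τ b ω)) P := by
  rw [← h.law b] at hf
  exact hf.comp_measurable (h.meas b)

lemma integral_comp (h : IIDWeights P τ ν ρ₀) (b : Bond d) {f : ℝ → ℝ}
    (hf : AEStronglyMeasurable f ν) : ∫ ω, f (τ b ω) ∂P = ∫ x, f x ∂ν := by
  rw [← h.law b] at hf ⊢
  exact (integral_map (h.meas b).aemeasurable hf).symm

lemma integrable_exp (h : IIDWeights P τ ν ρ₀) (b : Bond d) :
    Integrable (fun ω => Real.exp (ρ₀ * τ b ω)) P :=
  h.integrable_comp b h.exp_int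

lemma integrable_sq (h : IIDWeights P τ ν ρ₀) (b : Bond d) :
    Integrable (fun ω => τ b ω ^ 2) P := by
  refine ((h.integrable_exp b).const_mul (2 / ρ₀ ^ 2)).mono'
    ((h.meas b).pow_const 2).aestronglyMeasurable (Eventually.of_forall fun ω => ?_)
  have h1 := Real.quadratic_le_exp_of_nonneg (mul_nonneg h.rate_pos.le (h.nonneg b ω))
  have h2 := mul_nonneg h.rate_pos.le (h.nonneg b ω)
  have h3 : 0 < ρ₀ ^ 2 := pow_pos h.rate_pos 2
  rw [Real.norm_of_nonneg (sq_nonneg _), div_mul_eq_mul_div, le_div_iff₀ h3]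
  nlinarith

lemma integrable [IsProbabilityMeasure P] (h : IIDWeights P τ ν ρ₀) (b : Bond d) :
    Integrable (τ b) P :=
  (MemLp.integrable one_le_two
    ((memLp_two_iff_integrable_sq (h.meas b).aestronglyMeasurable).2 (h.integrable_sq b)))

lemma integrable_passage [IsProbabilityMeasure P] (h : IIDWeights P τ ν ρ₀) (x y : Fin d → ℤ) :
    Integrable (fun ω => passage (config τ ω) x y) P := by
  obtain ⟨γ⟩ := lattice_reachable x y
  obtain ⟨A, -, hA⟩ := exists_bonds_of_walk γ
  refine (integrable_finsetSum A fun b _ => h.integrable b).mono'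
    ((measurable_passage x y).comp h.measurable_config).aestronglyMeasurable
    (Eventually.of_forall fun ω => ?_)
  rw [Real.norm_of_nonneg (passage_nonneg (h.config_nonneg ω) x y)]
  exact (hA _ (h.config_nonneg ω)).1

lemma integral_passage_add [IsProbabilityMeasure P] (h : IIDWeights P τ ν ρ₀)
    (x y z : Fin d → ℤ) :
    ∫ ω, passage (config τ ω) (x + z) (y + z) ∂P = ∫ ω, passage (config τ ω) x y ∂P := by
  have := ((h.identDistrib_shift z).comp (measurable_passage x y)).integral_eq
  refine Eq.trans ?_ this
  refine integral_congr_ae (Eventually.of_forall fun ω => ?_)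
  exact (passage_shift (h.config_nonneg ω) z x y).symm

/-- The expected passage times along a coordinate axis grow linearly, by Fekete's lemma. -/
lemma exists_rate [IsProbabilityMeasure P] (h : IIDWeights P τ ν ρ₀) (i : Fin d) :
    ∃ μ : ℝ, 0 ≤ μ ∧
      Tendsto (fun n : ℕ => (∫ ω, passage (config τ ω) 0 (axis i n) ∂P) / n) atTop (𝓝 μ) ∧
      ∀ n : ℕ, n * μ ≤ ∫ ω, passage (config τ ω) 0 (axis i n) ∂P := by
  set u : ℕ → ℝ := fun n => ∫ ω, passage (config τ ω) 0 (axis i n) ∂P with hu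
  have hsub : Subadditive u := by
    intro m n
    have h1 := h.integral_passage_add 0 (axis i n) (axis i m)
    rw [zero_add, axis_add] at h1
    simp only [hu]
    rw [← h1, ← integral_add (h.integrable_passage _ _) (h.integrable_passage _ _)]
    refine integral_mono (h.integrable_passage _ _)
      ((h.integrable_passage _ _).add (h.integrable_passage _ _)) fun ω => ?_
    have := passage_triangle (h.config_nonneg ω) 0 (axis i m) (axis i (m + n : ℕ))
    simpa [add_comm] using this
  have hnn : ∀ n, 0 ≤ u n := fun n =>
    integral_nonneg fun ω => passage_nonneg (h.config_nonneg ω) _ _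
  have hbdd : BddBelow (Set.range fun n => u n / n) :=
    ⟨0, by rintro _ ⟨n, rfl⟩; exact div_nonneg (hnn n) n.cast_nonneg⟩
  have hlim := hsub.tendsto_lim hbdd
  refine ⟨hsub.lim, ge_of_tendsto' hlim fun n => div_nonneg (hnn n) n.cast_nonneg, hlim, ?_⟩
  intro n
  rcases Nat.eq_zero_or_pos n with rfl | hn
  · rw [Nat.cast_zero, zero_mul]; exact hnn 0
  · have := hsub.lim_le_div hbdd hn.ne'
    rwa [le_div_iff₀ (by exact_mod_cast hn), mul_comm] at this

/-- The expected passage time is approximated by that of a minimum over finitely many walks, a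
function of finitely many weights. -/
lemma exists_finite_approx [IsProbabilityMeasure P] (h : IIDWeights P τ ν ρ₀) (i : Fin d) (n : ℕ)
    {η : ℝ} (hη : ∫ ω, passage (config τ ω) 0 (axis i n) ∂P < η) :
    ∃ (U : (Bond d → ℝ) → ℝ) (S : Finset (Bond d)), Measurable U ∧
      (∀ w w', (∀ b ∈ S, w b = w' b) → U w = U w') ∧
      (∀ w, (∀ b, 0 ≤ w b) → passage w 0 (axis i n) ≤ U w ∧
        U w ≤ ∑ k ∈ Finset.range n, w (axis i k, i)) ∧
      ∫ ω, U (config τ ω) ∂P < η := by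
  classical
  have e0 : (0 : Fin d → ℤ) + axis i n = axis i n := zero_add _
  set γ₀ : (lattice d).Walk 0 (axis i n) := (straightWalk 0 i n).copy rfl e0 with hγ₀
  have ht₀ : ∀ w, walkTime w γ₀ = ∑ k ∈ Finset.range n, w (axis i k, i) := by
    intro w
    have := walkTime_straightWalk w 0 i n
    rw [walkTime_eq_sum] at this
    rw [walkTime_eq_sum, hγ₀, SimpleGraph.Walk.edges_copy, this]
    simp
  have : Nonempty ((lattice d).Walk 0 (axis i n)) := ⟨γ₀⟩
  obtain ⟨f, hf⟩ := exists_surjective_nat ((lattice d).Walk 0 (axis i n))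
  -- the minimum over the straight walk and the first `N` walks of an enumeration
  let U : ℕ → (Bond d → ℝ) → ℝ := fun N w =>
    Nat.rec (walkTime w γ₀) (fun k u => min u (walkTime w (f k))) N
  have hU0 : ∀ w, U 0 w = walkTime w γ₀ := fun _ => rfl
  have hUs : ∀ N w, U (N + 1) w = min (U N w) (walkTime w (f N)) := fun _ _ => rfl
  have hmeas : ∀ N, Measurable (U N) := by
    intro N
    induction N with
    | zero => exact measurable_walkTime γ₀
    | succ N ih => exact ih.min (measurable_walkTime (f N))
  have hdep : ∀ N, ∃ S : Finset (Bond d), ∀ w w', (∀ b ∈ S, w b = w' b) → U N w = U N w' := by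
    intro N
    induction N with
    | zero => exact ⟨walkBonds γ₀, fun w w' hw => walkTime_congr γ₀ hw⟩
    | succ N ih =>
      obtain ⟨S, hS⟩ := ih
      refine ⟨S ∪ walkBonds (f N), fun w w' hw => ?_⟩
      rw [hUs, hUs, hS w w' fun b hb => hw b (Finset.mem_union_left _ hb),
        walkTime_congr (f N) fun b hb => hw b (Finset.mem_union_right _ hb)]
  have hanti : ∀ w, Antitone fun N => U N w := fun w =>
    antitone_nat_of_succ_le fun N => by rw [hUs]; exact min_le_left _ _
  have hge : ∀ w, (∀ b, 0 ≤ w b) → ∀ N, passage w 0 (axis i n) ≤ U N w := by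
    intro w hw N
    induction N with
    | zero => exact passage_le_walkTime hw γ₀
    | succ N ih => rw [hUs]; exact le_min ih (passage_le_walkTime hw _)
  have hle : ∀ w N, U N w ≤ ∑ k ∈ Finset.range n, w (axis i k, i) := by
    intro w N
    rw [← ht₀]
    exact hanti w (Nat.zero_le N)
  have hlim : ∀ w, (∀ b, 0 ≤ w b) →
      Tendsto (fun N => U N w) atTop (𝓝 (passage w 0 (axis i n))) := by
    intro w hw
    have hb : BddBelow (Set.range fun N => U N w) :=
      ⟨passage w 0 (axis i n), by rintro _ ⟨N, rfl⟩; exact hge w hw N⟩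
    have := tendsto_atTop_ciInf (hanti w) hb
    convert this using 2
    refine le_antisymm (le_ciInf (hge w hw)) (le_passage fun γ => ?_)
    obtain ⟨k, rfl⟩ := hf γ
    exact (ciInf_le hb (k + 1)).trans (by rw [hUs]; exact min_le_right _ _)
  have hint : Tendsto (fun N => ∫ ω, U N (config τ ω) ∂P) atTop
      (𝓝 (∫ ω, passage (config τ ω) 0 (axis i n) ∂P)) := by
    refine tendsto_integral_of_dominated_convergence
      (fun ω => ∑ k ∈ Finset.range n, τ (axis i k, i) ω)
      (fun N => ((hmeas N).comp h.measurable_config).aestronglyMeasurable)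
      (integrable_finsetSum _ fun k _ => h.integrable _)
      (fun N => Eventually.of_forall fun ω => ?_)
      (Eventually.of_forall fun ω => hlim _ (h.config_nonneg ω))
    rw [Real.norm_of_nonneg
      ((passage_nonneg (h.config_nonneg ω) _ _).trans (hge _ (h.config_nonneg ω) N))]
    exact hle _ N
  obtain ⟨N, hN⟩ := (hint.eventually_lt_const hη).exists
  obtain ⟨S, hS⟩ := hdep N
  exact ⟨U N, S, hmeas N, hS, fun w hw => ⟨hge w hw N, hle w N⟩, hN⟩

/-- Exponential Markov inequality for a sum of independent weights, truncated at height `A`. -/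
lemma measure_sum_gt_le [IsProbabilityMeasure P] (h : IIDWeights P τ ν ρ₀) (F : Finset (Bond d))
    {ρ A : ℝ} (hρ : 0 ≤ ρ) (hA : 0 ≤ A) (u : ℝ) :
    P.real {ω | u < ∑ b ∈ F, τ b ω} ≤
      F.card * ((∫ x, Real.exp (ρ₀ * x) ∂ν) * Real.exp (-ρ₀ * A)) +
        Real.exp (-ρ * u) * (1 + ∫ x in Set.Iic A, Real.exp (ρ * x) ∂ν) ^ F.card := by
  set g : ℝ → ℝ := fun x => if x ≤ A then x else 0 with hg
  have hgm : Measurable g := Measurable.ite measurableSet_Iic measurable_id measurable_const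
  have hgA : ∀ x, g x ≤ A := by
    intro x
    simp only [hg]; split_ifs with hx
    · exact hx
    · exact hA
  have hν : IsProbabilityMeasure P → ∀ b : Bond d, IsProbabilityMeasure ν := fun _ b => by
    rw [← h.law b]; exact Measure.isProbabilityMeasure_map (h.meas b).aemeasurable
  have hbig : ∀ b, P.real {ω | A < τ b ω} ≤
      (∫ x, Real.exp (ρ₀ * x) ∂ν) * Real.exp (-ρ₀ * A) := by
    intro b
    have h1 := measure_ge_le_exp_mul_mgf (μ := P) (X := τ b) A h.rate_pos.le (h.integrable_exp b)
    have h2 : mgf (τ b) P ρ₀ = ∫ x, Real.exp (ρ₀ * x) ∂ν :=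
      h.integral_comp b h.exp_int.aestronglyMeasurable
    rw [h2, mul_comm] at h1
    exact (measureReal_mono fun ω (hω : A < τ b ω) => hω.le).trans h1
  have hX : iIndepFun (fun b ω => g (τ b ω)) P := h.indep.comp (fun _ => g) fun _ => hgm
  have hXm : ∀ b, Measurable fun ω => g (τ b ω) := fun b => hgm.comp (h.meas b)
  have hXint : ∀ b, Integrable (fun ω => Real.exp (ρ * g (τ b ω))) P := fun b =>
    integrable_exp_mul_of_le ρ A hρ (hXm b).aemeasurable (Eventually.of_forall fun ω => hgA _)
  have hmgf : ∀ b, mgf (fun ω => g (τ b ω)) P ρ ≤ 1 + ∫ x in Set.Iic A, Real.exp (ρ * x) ∂ν := by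
    intro b
    have := hν inferInstance b
    have e1 : mgf (fun ω => g (τ b ω)) P ρ = ∫ x, Real.exp (ρ * g x) ∂ν :=
      h.integral_comp b (f := fun x => Real.exp (ρ * g x))
        (Real.measurable_exp.comp (hgm.const_mul ρ)).aestronglyMeasurable
    have hI : IntegrableOn (fun x => Real.exp (ρ * x)) (Set.Iic A) ν := by
      refine Measure.integrableOn_of_bounded (M := Real.exp (ρ * A)) (measure_ne_top _ _)
        (by fun_prop) ?_
      refine (ae_restrict_iff' measurableSet_Iic).2 (Eventually.of_forall fun x hx => ?_)
      rw [Real.norm_of_nonneg (Real.exp_pos _).le]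
      exact Real.exp_le_exp.2 (mul_le_mul_of_nonneg_left hx hρ)
    rw [e1, ← integral_indicator measurableSet_Iic]
    have e2 : (1 : ℝ) = ∫ _x, (1 : ℝ) ∂ν := by simp
    rw [e2, ← integral_add (integrable_const _) ((integrable_indicator_iff measurableSet_Iic).2 hI)]
    refine integral_mono_of_nonneg (Eventually.of_forall fun x => (Real.exp_pos _).le)
      ((integrable_const _).add ((integrable_indicator_iff measurableSet_Iic).2 hI))
      (Eventually.of_forall fun x => ?_)
    by_cases hx : x ≤ A
    · simp [hg, Set.indicator, hx]
    · simp [hg, Set.indicator, hx]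
  have hsum : P.real {ω | u ≤ ∑ b ∈ F, g (τ b ω)} ≤
      Real.exp (-ρ * u) * (1 + ∫ x in Set.Iic A, Real.exp (ρ * x) ∂ν) ^ F.card := by
    have h1 := measure_ge_le_exp_mul_mgf (μ := P) (X := ∑ b ∈ F, fun ω => g (τ b ω)) u hρ
      (hX.integrable_exp_mul_sum hXm fun b _ => hXint b)
    rw [hX.mgf_sum hXm] at h1
    simp only [Finset.sum_apply] at h1
    refine h1.trans (mul_le_mul_of_nonneg_left ?_ (Real.exp_pos _).le)
    exact (Finset.prod_le_prod (fun b _ => mgf_nonneg) fun b _ => hmgf b).trans_eq (by simp)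
  have hcover : {ω | u < ∑ b ∈ F, τ b ω} ⊆
      (⋃ b ∈ F, {ω | A < τ b ω}) ∪ {ω | u ≤ ∑ b ∈ F, g (τ b ω)} := by
    intro ω hω
    by_cases hc : ∀ b ∈ F, τ b ω ≤ A
    · right
      have : ∑ b ∈ F, g (τ b ω) = ∑ b ∈ F, τ b ω :=
        Finset.sum_congr rfl fun b hb => if_pos (hc b hb)
      simp only [Set.mem_ofPred_eq] at hω ⊢
      rw [this]; exact hω.le
    · left
      push Not at hc
      obtain ⟨b, hb, hAb⟩ := hc
      exact Set.mem_biUnion hb hAb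
  refine (measureReal_mono hcover).trans ((measureReal_union_le _ _).trans (add_le_add ?_ hsum))
  refine (measureReal_biUnion_finset_le F _).trans ?_
  exact (Finset.sum_le_sum fun b _ => hbig b).trans_eq (by simp)

end IIDWeights

/-! ### Parallel tubes -/

/-- Below any level above its mean, a variable with exponential moments around `0` satisfies a
nontrivial exponential Markov bound. -/
lemma exists_mgf_le_exp [IsProbabilityMeasure P] {X : Ω → ℝ} {a : ℝ}
    (h0 : 0 ∈ interior (integrableExpSet X P)) (ha : ∫ ω, X ω ∂P < a) :
    ∃ θ l : ℝ, 0 < θ ∧ 0 < l ∧ Integrable (fun ω => Real.exp (θ * X ω)) P ∧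
      mgf X P θ ≤ Real.exp (θ * a - l) := by
  have hd : HasDerivAt (fun t => mgf X P t * Real.exp (-(t * a))) ((∫ ω, X ω ∂P) - a) 0 := by
    have h1 := hasDerivAt_mgf h0
    have h2 : HasDerivAt (fun t : ℝ => Real.exp (-(t * a))) (-a) 0 := by
      have := ((hasDerivAt_id (0 : ℝ)).mul_const a).neg.exp
      simpa using this
    have h3 := h1.mul h2
    simp only [zero_mul, neg_zero, Real.exp_zero, mul_one, mgf_zero, one_mul,
      ← sub_eq_add_neg] at h3
    exact h3
  have hev : ∀ᶠ t in 𝓝[>] (0 : ℝ), mgf X P t * Real.exp (-(t * a)) < 1 := by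
    have h1 := hd.hasDerivWithinAt (s := Set.Ioi 0)
    rw [hasDerivWithinAt_iff_tendsto_slope' (by simp)] at h1
    filter_upwards [h1.eventually_lt_const (sub_neg.2 ha), self_mem_nhdsWithin] with t ht h0t
    rw [slope_def_field] at ht
    have h0t : (0 : ℝ) < t := h0t
    rw [div_lt_iff₀ (by linarith)] at ht
    simp only [zero_mul, neg_zero, Real.exp_zero, mul_one, mgf_zero, sub_zero] at ht
    linarith
  have hint : ∀ᶠ t in 𝓝[>] (0 : ℝ), t ∈ integrableExpSet X P :=
    nhdsWithin_le_nhds (mem_interior_iff_mem_nhds.1 h0)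
  obtain ⟨θ, ⟨h1, h2⟩, hθ⟩ := ((hev.and hint).and self_mem_nhdsWithin).exists
  have hpos := mgf_pos h2
  refine ⟨θ, -Real.log (mgf X P θ * Real.exp (-(θ * a))), hθ, ?_, h2, ?_⟩
  · exact neg_pos.2 (Real.log_neg (mul_pos hpos (Real.exp_pos _)) h1)
  · rw [Real.log_mul hpos.ne' (Real.exp_pos _).ne', Real.log_exp]
    have : θ * a - -(Real.log (mgf X P θ) + -(θ * a)) = Real.log (mgf X P θ) := by ring
    rw [this, Real.exp_log hpos]

/-- A constant factor does not affect exponential rates. -/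
lemma eventually_const_mul_exp_le (C : ℝ) {a b : ℝ} (hab : a < b) :
    ∀ᶠ n : ℕ in atTop, C * Real.exp (-b * n) ≤ Real.exp (-a * n) := by
  have h1 : Tendsto (fun n : ℕ => Real.exp ((b - a) * n)) atTop atTop :=
    Real.tendsto_exp_atTop.comp
      (tendsto_natCast_atTop_atTop.const_mul_atTop (sub_pos.2 hab))
  filter_upwards [h1.eventually_ge_atTop C] with n hn
  calc C * Real.exp (-b * n) ≤ Real.exp ((b - a) * n) * Real.exp (-b * n) :=
        mul_le_mul_of_nonneg_right hn (Real.exp_pos _).le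
    _ = Real.exp (-a * n) := by rw [← Real.exp_add]; congr 1; ring

lemma shift_nonneg {w : Bond d → ℝ} (hw : ∀ b, 0 ≤ w b) (z : Fin d → ℤ) (b : Bond d) :
    0 ≤ shift z w b := hw _

lemma measurable_shift (z : Fin d → ℤ) : Measurable (shift (d := d) z) :=
  measurable_pi_lambda _ fun _ => measurable_pi_apply _

/-- Families of variables over disjoint index sets are independent. -/
lemma iIndepFun_blocks {ι κ α β : Type*} [IsProbabilityMeasure P] [MeasurableSpace β]
    {X : α → Ω → β} (hX : iIndepFun X P) (hm : ∀ a, Measurable (X a))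
    {g : ι → κ → α} (hg : Function.Injective fun p : (_ : ι) × κ => g p.1 p.2) :
    iIndepFun (fun k ω (b : κ) => X (g k b) ω) P := by
  have hS := hX.precomp hg
  have h1 : ∀ k, iIndepFun (fun b => X (g k b)) P := fun k =>
    hX.precomp (g := g k) fun b b' hb => by
      have := @hg ⟨k, b⟩ ⟨k, b'⟩ hb
      simpa using this
  have : ∀ a, IsProbabilityMeasure (P.map (X a)) := fun a =>
    Measure.isProbabilityMeasure_map (hm a).aemeasurable
  have : ∀ k, IsProbabilityMeasure (P.map (fun ω (b : κ) => X (g k b) ω)) := fun k =>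
    Measure.isProbabilityMeasure_map (Measurable.aemeasurable (by fun_prop))
  rw [iIndepFun_iff_map_fun_eq_infinitePi_map (by fun_prop)]
  have e : (fun ω k (b : κ) => X (g k b) ω) =
      (MeasurableEquiv.piCurry (fun (_ : ι) (_ : κ) => β)) ∘
      (fun ω p => X (g p.1 p.2) ω) := by
    ext; simp [Sigma.curry]
  rw [e, ← Measure.map_map (by fun_prop) (by fun_prop),
    (iIndepFun_iff_map_fun_eq_infinitePi_map (fun p => hm _)).1 hS]
  have h3 := Measure.infinitePi_map_piCurry (X := fun (_ : ι) (_ : κ) => β)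
    (fun i j ↦ P.map (X (g i j)))
  refine Eq.trans h3 ?_
  congrm Measure.infinitePi fun i ↦ ?_
  rw [(iIndepFun_iff_map_fun_eq_infinitePi_map (by fun_prop)).1 (h1 i)]

/-- Subadditivity along an axis: a segment is crossed block by block, each block at cost `U`. -/
lemma passage_le_sum_of_blocks {U : (Bond d → ℝ) → ℝ} {i : Fin d} {n₀ : ℕ}
    (hU : ∀ w, (∀ b, 0 ≤ w b) → passage w 0 (axis i n₀) ≤ U w) {w : Bond d → ℝ}
    (hw : ∀ b, 0 ≤ w b) (s : Fin d → ℤ) (k : ℕ) :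
    passage w s (s + axis i (k * n₀ : ℕ)) ≤
      ∑ k' ∈ Finset.range k, U (shift (s + axis i (k' * n₀ : ℕ)) w) := by
  induction k with
  | zero => simp [passage_self hw]
  | succ k ih =>
    rw [Finset.sum_range_succ]
    refine (passage_triangle hw s (s + axis i (k * n₀ : ℕ)) _).trans (add_le_add ih ?_)
    refine le_trans (le_of_eq ?_) (hU _ (shift_nonneg hw _))
    rw [passage_shift hw, zero_add]
    congr 1
    rw [add_left_comm, axis_add]
    congr 2
    push_cast; ring

lemma sum_range_mul_eq (f : ℕ → ℝ) (q M : ℕ) :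
    ∑ k ∈ Finset.range (q * M), f k
      = ∑ p ∈ Finset.range q, ∑ r ∈ Finset.range M, f (p * M + r) := by
  induction q with
  | zero => simp
  | succ q ih => rw [Nat.succ_mul, Finset.sum_range_add, ih, Finset.sum_range_succ]

/-- Exponential Markov inequality for a sum of independent copies of `Y`. -/
lemma measure_sum_ge_le_pow [IsProbabilityMeasure P] {ι : Type*} {X : ι → Ω → ℝ}
    (hX : iIndepFun X P) (hm : ∀ k, Measurable (X k)) {Y : Ω → ℝ}
    (hXY : ∀ k, IdentDistrib (X k) Y P P) {θ : ℝ} (hθ : 0 ≤ θ)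
    (hint : Integrable (fun ω => Real.exp (θ * Y ω)) P) (s : Finset ι) (u : ℝ) :
    P.real {ω | u ≤ ∑ k ∈ s, X k ω} ≤ Real.exp (-θ * u) * mgf Y P θ ^ s.card := by
  have hi : ∀ k, Integrable (fun ω => Real.exp (θ * X k ω)) P := fun k =>
    (((hXY k).comp (u := fun x => Real.exp (θ * x)) (by fun_prop)).integrable_iff).2 hint
  have h1 := measure_ge_le_exp_mul_mgf (μ := P) (X := ∑ k ∈ s, X k) u hθ
      (hX.integrable_exp_mul_sum hm fun k _ => hi k)
  have h2 : ∀ k, mgf (X k) P θ = mgf Y P θ := fun k => by rw [mgf_congr_identDistrib (hXY k)]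
  rw [hX.mgf_sum hm, Finset.prod_congr rfl fun k _ => h2 k, Finset.prod_const] at h1
  simpa only [Finset.sum_apply] using h1

namespace IIDWeights

lemma config_shift_nonneg (h : IIDWeights P τ ν ρ₀) (ω : Ω) (z : Fin d → ℤ) (b : Bond d) :
    0 ≤ shift z (config τ ω) b := h.nonneg _ _

lemma one_le_expMoment [IsProbabilityMeasure P] (h : IIDWeights P τ ν ρ₀) (b : Bond d) :
    1 ≤ ∫ x, Real.exp (ρ₀ * x) ∂ν := by
  rw [← h.integral_comp b h.exp_int.aestronglyMeasurable]
  have e2 : (1 : ℝ) = ∫ _ω, (1 : ℝ) ∂P := by simp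
  rw [e2]
  refine integral_mono (integrable_const _) (h.integrable_exp b) fun ω => ?_
  exact Real.one_le_exp (mul_nonneg h.rate_pos.le (h.nonneg b ω))

/-- Functions of disjoint translates of a finite set of labels are independent. -/
lemma iIndepFun_shift [IsProbabilityMeasure P] (h : IIDWeights P τ ν ρ₀) {U : (Bond d → ℝ) → ℝ}
    {S : Finset (Bond d)} (hU : Measurable U) (hS : ∀ w w', (∀ b ∈ S, w b = w' b) → U w = U w')
    {ι : Type*} (z : ι → Fin d → ℤ)
    (hz : ∀ k k', k ≠ k' → ∀ b ∈ S, ∀ b' ∈ S, b.1 + z k ≠ b'.1 + z k') :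
    iIndepFun (fun k ω => U (shift (z k) (config τ ω))) P := by
  classical
  have hg : Function.Injective
      fun p : (_ : ι) × S => ((p.2.1.1 + z p.1, p.2.1.2) : Bond d) := by
    rintro ⟨k, b, hb⟩ ⟨k', b', hb'⟩ he
    have h1 := (Prod.ext_iff.1 he).1
    have h2 := (Prod.ext_iff.1 he).2
    by_cases hk : k = k'
    · subst hk
      have : b = b' := Prod.ext (add_right_cancel h1) h2
      subst this; rfl
    · exact absurd h1 (hz k k' hk b hb b' hb')
  set φ : (S → ℝ) → ℝ := fun v => U fun b => if hb : b ∈ S then v ⟨b, hb⟩ else 0 with hφ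
  have hφm : Measurable φ := by
    refine hU.comp (measurable_pi_lambda _ fun b => ?_)
    split_ifs
    · exact measurable_pi_apply _
    · exact measurable_const
  have := (iIndepFun_blocks h.indep h.meas
    (g := fun k (b : S) => ((b.1.1 + z k, b.1.2) : Bond d)) hg).comp (fun _ => φ) fun _ => hφm
  convert this using 2 with k
  funext ω
  refine hS _ _ fun b hb => ?_
  rw [dif_pos hb]
  rfl

lemma identDistrib_comp_shift [IsProbabilityMeasure P] (h : IIDWeights P τ ν ρ₀)
    {U : (Bond d → ℝ) → ℝ} (hU : Measurable U) (z : Fin d → ℤ) :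
    IdentDistrib (fun ω => U (shift z (config τ ω))) (fun ω => U (config τ ω)) P P :=
  (h.identDistrib_shift z).comp hU

/-- A nonnegative variable dominated by a sum of distinct weights has exponential moments
around `0`. -/
lemma zero_mem_interior_integrableExpSet [IsProbabilityMeasure P] (h : IIDWeights P τ ν ρ₀)
    {X : Ω → ℝ} (hX : Measurable X) (h0 : ∀ ω, 0 ≤ X ω) {ι : Type*} {g : ι → Bond d}
    (hg : Function.Injective g) (s : Finset ι) (hle : ∀ ω, X ω ≤ ∑ k ∈ s, τ (g k) ω) :
    0 ∈ interior (integrableExpSet X P) := by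
  rw [mem_interior_iff_mem_nhds]
  filter_upwards [Iio_mem_nhds h.rate_pos] with t (ht : t < ρ₀)
  have hI := (h.indep.precomp hg).integrable_exp_mul_sum (t := ρ₀) (fun k => h.meas _) (s := s)
    fun k _ => h.integrable_exp _
  refine hI.mono' (by fun_prop) (Eventually.of_forall fun ω => ?_)
  rw [Real.norm_of_nonneg (Real.exp_pos _).le, Finset.sum_apply]
  refine Real.exp_le_exp.2 ?_
  calc t * X ω ≤ ρ₀ * X ω := mul_le_mul_of_nonneg_right ht.le (h0 ω)
    _ ≤ _ := mul_le_mul_of_nonneg_left (hle ω) h.rate_pos.le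

/-- Sufficiently many disjoint tubes parallel to the axis `i₀`: the average of their crossing times
exceeds `n (μ + ε)` with probability at most `exp (-B n)`, with `B` as large as desired. -/
lemma tube_bound [IsProbabilityMeasure P] (h : IIDWeights P τ ν ρ₀) {i₀ i₁ : Fin d}
    (h01 : i₀ ≠ i₁) {μ : ℝ}
    (hlim : Tendsto (fun n : ℕ => (∫ ω, passage (config τ ω) 0 (axis i₀ n) ∂P) / n) atTop (𝓝 μ))
    (hμ : 0 ≤ μ) {ε : ℝ} (hε : 0 < ε) (B : ℝ) :
    ∃ m W : ℕ, 0 < m ∧ ∀ᶠ n : ℕ in atTop,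
      P.real {ω | m * n * (μ + ε) < ∑ j ∈ Finset.range m, passage (config τ ω)
        (axis i₁ ((j + 1) * W : ℕ)) (axis i₁ ((j + 1) * W : ℕ) + axis i₀ n)} ≤
        Real.exp (-B * n) := by
  obtain ⟨n₀, hn₀, hn₀pos⟩ : ∃ n₀ : ℕ,
      (∫ ω, passage (config τ ω) 0 (axis i₀ n₀) ∂P) / n₀ < μ + ε / 2 ∧ 0 < n₀ :=
    ((hlim.eventually_lt_const (by linarith : μ < μ + ε / 2)).and (eventually_gt_atTop 0)).exists
  have hn₀R : (0 : ℝ) < n₀ := by exact_mod_cast hn₀pos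
  set a : ℝ := (μ + ε / 2) * n₀ with ha
  rw [div_lt_iff₀ hn₀R] at hn₀
  obtain ⟨U, S, hUm, hUS, hUle, hUint⟩ := h.exists_finite_approx i₀ n₀ hn₀
  -- the labels used by `U` lie in a box of radius `R`
  obtain ⟨R, hR⟩ : ∃ R : ℕ, ∀ b ∈ S, ∀ i, |b.1 i| ≤ R := by
    refine ⟨∑ b ∈ S, ∑ i, (b.1 i).natAbs, fun b hb i => ?_⟩
    have h1 : (b.1 i).natAbs ≤ ∑ i, (b.1 i).natAbs :=
      Finset.single_le_sum (f := fun i => (b.1 i).natAbs) (fun _ _ => Nat.zero_le _)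
        (Finset.mem_univ i)
    have h2 : ∑ i, (b.1 i).natAbs ≤ ∑ b ∈ S, ∑ i, (b.1 i).natAbs :=
      Finset.single_le_sum (f := fun b : Bond d => ∑ i, (b.1 i).natAbs)
        (fun _ _ => Nat.zero_le _) hb
    have h3 := h1.trans h2
    rw [Int.abs_eq_natAbs]
    exact_mod_cast h3
  set M : ℕ := 2 * R + 1 with hM
  set L : ℕ := M * n₀ with hL
  have hLpos : 0 < L := Nat.mul_pos (by omega) hn₀pos
  have hLR : (0 : ℝ) < L := by exact_mod_cast hLpos
  have hUm' : ∀ z, Measurable fun ω => U (shift z (config τ ω)) := fun z =>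
    hUm.comp ((measurable_shift z).comp h.measurable_config)
  have hinj₀ : Function.Injective fun k : ℕ => ((axis i₀ (k : ℤ), i₀) : Bond d) := by
    intro k k' hk
    have := congrFun (Prod.ext_iff.1 hk).1 i₀
    simpa using this
  have h0mem : 0 ∈ interior (integrableExpSet (fun ω => U (config τ ω)) P) :=
    h.zero_mem_interior_integrableExpSet (hUm.comp h.measurable_config)
      (fun ω => (passage_nonneg (h.config_nonneg ω) _ _).trans (hUle _ (h.config_nonneg ω)).1)
      hinj₀ (Finset.range n₀) fun ω => (hUle _ (h.config_nonneg ω)).2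
  obtain ⟨θ, l, hθ, hl, hθint, hmgf⟩ := exists_mgf_le_exp h0mem hUint
  set E₀ : ℝ := ∫ x, Real.exp (ρ₀ * x) ∂ν with hE₀
  have hE₀1 : 1 ≤ E₀ := h.one_le_expMoment (0, i₀)
  -- with `m` tubes the exponents `l m / (2 L)` for the blocks and `ρ₀ ε m / 2` for the edges after
  -- the last block both exceed `B + 1`
  obtain ⟨m, hm⟩ := exists_nat_gt (max 1 (max ((B + 1) * (2 * L) / l) ((B + 1) * 2 / (ρ₀ * ε))))
  have hm1 : (1 : ℝ) < m := (le_max_left _ _).trans_lt hm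
  have hm2 : (B + 1) * (2 * L) / l < m :=
    ((le_max_left _ _).trans (le_max_right _ _)).trans_lt hm
  have hm3 : (B + 1) * 2 / (ρ₀ * ε) < m :=
    ((le_max_right _ _).trans (le_max_right _ _)).trans_lt hm
  have hmpos : 0 < m := by
    have : (0 : ℝ) < m := by linarith
    exact_mod_cast this
  rw [div_lt_iff₀ hl] at hm2
  rw [div_lt_iff₀ (mul_pos h.rate_pos hε)] at hm3
  refine ⟨m, M, hmpos, ?_⟩
  -- corners of the blocks; for a fixed residue `r` they are more than `2 R` apart, so that the
  -- blocks use disjoint sets of labels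
  set z : ℕ → ℕ × ℕ → Fin d → ℤ := fun r pj =>
    axis i₁ ((pj.2 + 1) * M : ℕ) + axis i₀ ((pj.1 * M + r) * n₀ : ℕ) with hz
  have hzsep : ∀ r k k', k ≠ k' → ∀ b ∈ S, ∀ b' ∈ S, b.1 + z r k ≠ b'.1 + z r k' := by
    rintro r ⟨p, j⟩ ⟨p', j'⟩ hne b hb b' hb' heq
    have e0 := congrFun heq i₀
    have e1 := congrFun heq i₁
    simp only [hz, Pi.add_apply, Pi.single_eq_same, Pi.single_eq_of_ne h01,
      Pi.single_eq_of_ne h01.symm, add_zero, zero_add] at e0 e1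
    have hb0 := abs_le.1 (hR b hb i₀)
    have hb1 := abs_le.1 (hR b hb i₁)
    have hc0 := abs_le.1 (hR b' hb' i₀)
    have hc1 := abs_le.1 (hR b' hb' i₁)
    have sep : ∀ (c : ℤ), 1 ≤ c → ∀ p p' : ℕ, p < p' →
        ∀ x y : ℤ, -R ≤ x → x ≤ R → -R ≤ y → y ≤ R →
        x + (p : ℤ) * (M * c) ≠ y + (p' : ℤ) * (M * c) := by
      intro c hc p p' hpp x y hx1 hx2 hy1 hy2 he
      have h1 : ((p' : ℤ) - p) * (M * c) = x - y := by linarith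
      have h2 : (1 : ℤ) ≤ (p' : ℤ) - p := by omega
      have h3 : (M : ℤ) = 2 * R + 1 := by rw [hM]; push_cast; ring
      have h4 : (M : ℤ) ≤ M * c := le_mul_of_one_le_right (by positivity) hc
      have h5 : (M : ℤ) * c ≤ ((p' : ℤ) - p) * (M * c) :=
        le_mul_of_one_le_left (by positivity) h2
      omega
    have hn1 : (1 : ℤ) ≤ n₀ := by exact_mod_cast hn₀pos
    rcases lt_trichotomy p p' with hp | hp | hp
    · refine sep n₀ hn1 p p' hp _ _ hb0.1 hb0.2 hc0.1 hc0.2 ?_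
      push_cast at e0; linarith
    · rcases lt_trichotomy j j' with hj | hj | hj
      · refine sep 1 le_rfl j j' hj _ _ hb1.1 hb1.2 hc1.1 hc1.2 ?_
        push_cast at e1; linarith
      · exact hne (by rw [hp, hj])
      · refine sep 1 le_rfl j' j hj _ _ hc1.1 hc1.2 hb1.1 hb1.2 ?_
        push_cast at e1; linarith
    · refine sep n₀ hn1 p' p hp _ _ hc0.1 hc0.2 hb0.1 hb0.2 ?_
      push_cast at e0; linarith
  have hblocks : ∀ (r q : ℕ), P.real {ω | q * m * a ≤
      ∑ k ∈ Finset.range q ×ˢ Finset.range m, U (shift (z r k) (config τ ω))} ≤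
      Real.exp (-l * (q * m)) := by
    intro r q
    have h1 := measure_sum_ge_le_pow (h.iIndepFun_shift hUm hUS (z r) (hzsep r))
      (fun k => hUm' _) (fun k => h.identDistrib_comp_shift hUm _) hθ.le hθint
      (Finset.range q ×ˢ Finset.range m) (q * m * a)
    refine h1.trans ?_
    rw [Finset.card_product, Finset.card_range, Finset.card_range]
    refine (mul_le_mul_of_nonneg_left (pow_le_pow_left₀ mgf_nonneg hmgf _)
      (Real.exp_pos _).le).trans_eq ?_
    rw [← Real.exp_nat_mul, ← Real.exp_add]
    congr 1
    push_cast; ring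
  -- the edges between the last complete block and the end of the tube
  set g : ℕ → ℕ × ℕ → Bond d := fun q ji =>
    (axis i₁ ((ji.1 + 1) * M : ℕ) + axis i₀ (q * L : ℕ) + axis i₀ ji.2, i₀) with hg
  have hginj : ∀ q, Function.Injective (g q) := by
    rintro q ⟨j, i⟩ ⟨j', i'⟩ heq
    have heq := (Prod.ext_iff.1 heq).1
    have e0 := congrFun heq i₀
    have e1 := congrFun heq i₁
    simp only [hg, Pi.add_apply, Pi.single_eq_same, Pi.single_eq_of_ne h01,
      Pi.single_eq_of_ne h01.symm, add_zero, zero_add] at e0 e1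
    have e0' : i = i' := by omega
    have e1' : (j + 1) * M = (j' + 1) * M := by exact_mod_cast e1
    have := Nat.eq_of_mul_eq_mul_right (by omega : 0 < M) e1'
    rw [e0']; congr 1; omega
  have hrest : ∀ (q t : ℕ) (u : ℝ), t ≤ L → P.real {ω | u ≤
      ∑ k ∈ Finset.range m ×ˢ Finset.range t, τ (g q k) ω} ≤
      E₀ ^ (m * L) * Real.exp (-ρ₀ * u) := by
    intro q t u ht
    have h1 := measure_sum_ge_le_pow (h.indep.precomp (hginj q)) (fun k => h.meas _)
      (Y := τ (0, i₀)) (fun k => ⟨(h.meas _).aemeasurable, (h.meas _).aemeasurable,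
        by rw [h.law]; exact (h.law _).symm⟩) h.rate_pos.le
      (h.integrable_exp _) (Finset.range m ×ˢ Finset.range t) u
    refine h1.trans ?_
    have h2 : mgf (τ (0, i₀)) P ρ₀ = E₀ := h.integral_comp _ h.exp_int.aestronglyMeasurable
    rw [Finset.card_product, Finset.card_range, Finset.card_range, h2, mul_comm]
    exact mul_le_mul_of_nonneg_right
      (pow_le_pow_right₀ hE₀1 (Nat.mul_le_mul_left m ht)) (Real.exp_pos _).le
  have hfin := eventually_const_mul_exp_le (M + E₀ ^ (m * L)) (a := B) (b := B + 1) (by linarith)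
  filter_upwards [hfin, eventually_ge_atTop (2 * L)] with n hn hn2
  set q := n / L with hq
  set t := n % L with ht
  have hnq : q * L + t = n := by rw [mul_comm]; exact Nat.div_add_mod n L
  have htL : t < L := Nat.mod_lt n hLpos
  have hnqR : (q : ℝ) * L + t = n := by exact_mod_cast hnq
  have htR : (t : ℝ) < L := by exact_mod_cast htL
  have hn2R : 2 * (L : ℝ) ≤ n := by exact_mod_cast hn2
  have hcover : {ω | m * n * (μ + ε) < ∑ j ∈ Finset.range m, passage (config τ ω)
        (axis i₁ ((j + 1) * M : ℕ)) (axis i₁ ((j + 1) * M : ℕ) + axis i₀ n)} ⊆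
      (⋃ r ∈ Finset.range M, {ω | q * m * a ≤
        ∑ k ∈ Finset.range q ×ˢ Finset.range m, U (shift (z r k) (config τ ω))}) ∪
      {ω | m * n * (ε / 2) ≤ ∑ k ∈ Finset.range m ×ˢ Finset.range t, τ (g q k) ω} := by
    intro ω hω
    by_contra hcon
    simp only [Set.mem_union, Set.mem_iUnion, Set.mem_ofPred_eq, not_or, not_exists, not_le,
      Finset.mem_range] at hcon hω
    obtain ⟨hc1, hc2⟩ := hcon
    have htube : ∀ j, passage (config τ ω) (axis i₁ ((j + 1) * M : ℕ))
        (axis i₁ ((j + 1) * M : ℕ) + axis i₀ n) ≤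
        (∑ p ∈ Finset.range q, ∑ r ∈ Finset.range M, U (shift (z r (p, j)) (config τ ω))) +
        ∑ i ∈ Finset.range t, τ (g q (j, i)) ω := by
      intro j
      refine (passage_triangle (h.config_nonneg ω) _
        (axis i₁ ((j + 1) * M : ℕ) + axis i₀ (q * L : ℕ)) _).trans (add_le_add ?_ ?_)
      · have h1 := passage_le_sum_of_blocks (fun w hw => (hUle w hw).1) (h.config_nonneg ω)
          (axis i₁ ((j + 1) * M : ℕ)) (q * M)
        rw [sum_range_mul_eq, mul_assoc, ← hL] at h1
        exact h1
      · have h1 := passage_le_straight (h.config_nonneg ω)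
          (axis i₁ ((j + 1) * M : ℕ) + axis i₀ (q * L : ℕ)) i₀ t
        rw [add_assoc, axis_add, ← Nat.cast_add, hnq] at h1
        exact h1
    have hsum := Finset.sum_le_sum fun j (_ : j ∈ Finset.range m) => htube j
    rw [Finset.sum_add_distrib] at hsum
    have e1 : ∑ j ∈ Finset.range m, ∑ p ∈ Finset.range q, ∑ r ∈ Finset.range M,
        U (shift (z r (p, j)) (config τ ω)) = ∑ r ∈ Finset.range M,
        ∑ k ∈ Finset.range q ×ˢ Finset.range m, U (shift (z r k) (config τ ω)) := by
      rw [Finset.sum_comm, ← Finset.sum_product', Finset.sum_comm]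
    have e2 : ∑ j ∈ Finset.range m, ∑ i ∈ Finset.range t, τ (g q (j, i)) ω =
        ∑ k ∈ Finset.range m ×ˢ Finset.range t, τ (g q k) ω := by
      rw [← Finset.sum_product']
    rw [e1, e2] at hsum
    have hle : ∑ r ∈ Finset.range M, ∑ k ∈ Finset.range q ×ˢ Finset.range m,
        U (shift (z r k) (config τ ω)) ≤ M * (q * m * a) := by
      refine (Finset.sum_le_sum fun r hr => (hc1 r (Finset.mem_range.1 hr)).le).trans_eq ?_
      rw [Finset.sum_const, Finset.card_range, nsmul_eq_mul]
    have hLR' : (L : ℝ) = M * n₀ := by rw [hL]; push_cast; ring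
    have e3 : (M : ℝ) * (q * m * a) = m * (q * L) * (μ + ε / 2) := by rw [ha, hLR']; ring
    have h5 : (m : ℝ) * (q * L) * (μ + ε / 2) ≤ m * n * (μ + ε / 2) := by
      refine mul_le_mul_of_nonneg_right (mul_le_mul_of_nonneg_left ?_ (by positivity))
        (by positivity)
      have : (0 : ℝ) ≤ t := by positivity
      linarith
    have h6 : (m : ℝ) * n * (μ + ε) = m * n * (μ + ε / 2) + m * n * (ε / 2) := by ring
    linarith
  refine (measureReal_mono hcover).trans ((measureReal_union_le _ _).trans ?_)
  refine le_trans ?_ hn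
  rw [add_mul]
  refine add_le_add ?_ ?_
  · refine (measureReal_biUnion_finset_le _ _).trans ?_
    refine (Finset.sum_le_sum fun r _ => hblocks r q).trans ?_
    rw [Finset.sum_const, Finset.card_range, nsmul_eq_mul]
    refine mul_le_mul_of_nonneg_left (Real.exp_le_exp.2 ?_) (by positivity)
    -- `q ≥ n / (2 L)` since `n ≥ 2 L`
    have h1 : (n : ℝ) ≤ q * (2 * L) := by linarith
    have h2 : (B + 1) * n * (2 * L) ≤ (l * (q * m)) * (2 * L) := by
      calc (B + 1) * n * (2 * L) = ((B + 1) * (2 * L)) * n := by ring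
        _ ≤ (m * l) * n := mul_le_mul_of_nonneg_right hm2.le (by positivity)
        _ ≤ (m * l) * (q * (2 * L)) := mul_le_mul_of_nonneg_left h1 (by positivity)
        _ = _ := by ring
    have h3 := le_of_mul_le_mul_right h2 (by positivity)
    linarith
  · refine (hrest q t _ htL.le).trans ?_
    refine mul_le_mul_of_nonneg_left (Real.exp_le_exp.2 ?_) (by positivity)
    have h1 : (B + 1) * 2 * n ≤ m * (ρ₀ * ε) * n :=
      mul_le_mul_of_nonneg_right hm3.le (by positivity)
    nlinarith

end IIDWeights

/-! ### The two bounds for the upper tail -/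

/-- Along `l`, weights of the order of `n` cost at least `β` per unit: for every `ρ < β` the
exponential moment of order `ρ` of the weight truncated at `C n` is subexponential in `n`. -/
def UpperCost (ν : Measure ℝ) (β : ℝ) (l : Filter ℕ) : Prop :=
  ∀ ρ, 0 < ρ → ρ < β → ∀ C : ℝ, 0 < C → ∀ δ : ℝ, 0 < δ →
    ∀ᶠ n : ℕ in l, ∫ x in Set.Iic (C * n), Real.exp (ρ * x) ∂ν ≤ Real.exp (δ * n)

/-- Along `l`, weights of the order of `n` cost at most `β` per unit: a weight exceeds `C n` with
probability at least `exp (-ρ C n)`, for every `ρ > β`. -/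
def LowerCost (ν : Measure ℝ) (β : ℝ) (l : Filter ℕ) : Prop :=
  ∀ ρ, β < ρ → ∀ C : ℝ, 0 < C →
    ∀ᶠ n : ℕ in l, Real.exp (-ρ * (C * n)) ≤ ν.real (Set.Ioi (C * n))

namespace IIDWeights

/-- The cost of a delay `n v` shared between the two endpoints: all `2d` edge-disjoint routes
have to be slow. -/
lemma end_bound [IsProbabilityMeasure P] (h : IIDWeights P τ ν ρ₀) {i₀ i₁ : Fin d} (h01 : i₀ ≠ i₁)
    {l : Filter ℕ} (hl : l ≤ atTop) {β : ℝ} (hβ : UpperCost ν β l) (k : ℕ) {v ρ δ : ℝ} (hv : 0 < v)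
    (hρ : 0 < ρ) (hρβ : ρ < β) (hδ : 0 < δ) :
    ∀ᶠ n : ℕ in l, P.real {ω | n * v < passage (config τ ω) 0 (axis i₁ k) +
      passage (config τ ω) (axis i₁ k + axis i₀ n) (axis i₀ n)} ≤
      Real.exp (-(2 * d * ρ * v - δ) * n) := by
  classical
  obtain ⟨F, hF⟩ := exists_bonds_passage_le i₀ i₁ h01 k
  obtain ⟨R, hR⟩ : ∃ R : ℕ, ∀ b ∈ F, (b.1 i₀).natAbs ≤ R :=
    ⟨∑ b ∈ F, (b.1 i₀).natAbs, fun b hb =>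
      Finset.single_le_sum (f := fun b : Bond d => (b.1 i₀).natAbs) (fun _ _ => Nat.zero_le _) hb⟩
  have hd : (0 : ℝ) ≤ d := d.cast_nonneg
  set N : ℕ := F.card + F.card with hN
  set E₀ : ℝ := ∫ x, Real.exp (ρ₀ * x) ∂ν with hE₀
  have hE₀1 : 1 ≤ E₀ := h.one_le_expMoment (0, i₀)
  set r : ℝ := 2 * d * ρ * v with hr
  have hr0 : 0 ≤ r := by positivity
  set C : ℝ := (r + 1) / ρ₀ with hC
  have hC0 : 0 < C := div_pos (by linarith) h.rate_pos
  have hρC : ρ₀ * C = r + 1 := mul_div_cancel₀ _ h.rate_pos.ne'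
  set δ' : ℝ := δ / (2 * (N + 1)) with hδ'
  have hδ'0 : 0 < δ' := by positivity
  have hδN : δ' * N ≤ δ / 2 := by
    rw [hδ', div_mul_eq_mul_div, div_le_div_iff₀ (by positivity) (by norm_num)]
    nlinarith
  have hfin := eventually_const_mul_exp_le (N * E₀ + 2 ^ N) (a := r - δ) (b := r - δ / 2)
    (by linarith)
  filter_upwards [hβ ρ hρ hρβ C hC0 δ' hδ'0, hl hfin, hl (eventually_gt_atTop (2 * R))]
    with n h1 h2 h3
  -- translates of the routes to the two endpoints are disjoint
  have hinj : Function.Injective fun b : Bond d => ((b.1 + axis i₀ n, b.2) : Bond d) :=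
    fun b b' hb => Prod.ext (add_right_cancel (Prod.ext_iff.1 hb).1) (Prod.ext_iff.1 hb).2
  set F' : Finset (Bond d) := F.image fun b => (b.1 + axis i₀ n, b.2) with hF'
  have hdisj : Disjoint F F' := by
    rw [Finset.disjoint_left]
    intro b hb hb'
    obtain ⟨c, hc, rfl⟩ := Finset.mem_image.1 hb'
    have e1 := hR _ hb
    have e2 := hR _ hc
    simp only [Pi.add_apply, Pi.single_eq_same] at e1
    omega
  have hcard : (F ∪ F').card = N := by
    rw [Finset.card_union_of_disjoint hdisj, hF', Finset.card_image_of_injective _ hinj]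
  have hcover : {ω | n * v < passage (config τ ω) 0 (axis i₁ k) +
      passage (config τ ω) (axis i₁ k + axis i₀ n) (axis i₀ n)} ⊆
      {ω | 2 * d * (n * v) < ∑ b ∈ F ∪ F', τ b ω} := by
    intro ω hω
    rw [Set.mem_ofPred_eq] at hω ⊢
    have g1 := hF _ (h.config_nonneg ω)
    have g2 := hF _ (h.config_shift_nonneg ω (axis i₀ n))
    rw [passage_shift (h.config_nonneg ω), zero_add, passage_comm (h.config_nonneg ω)] at g2
    rw [Finset.sum_union hdisj, hF', Finset.sum_image hinj.injOn]
    have g3 : ∑ b ∈ F, shift (axis i₀ n) (config τ ω) b =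
      ∑ b ∈ F, τ (b.1 + axis i₀ n, b.2) ω := rfl
    have g4 : ∑ b ∈ F, config τ ω b = ∑ b ∈ F, τ b ω := rfl
    rw [g3] at g2
    rw [g4] at g1
    have hdpos : (0 : ℝ) < d := by exact_mod_cast (Fin.pos i₀)
    have := mul_lt_mul_of_pos_left hω (by linarith : (0 : ℝ) < 2 * d)
    linarith
  refine (measureReal_mono hcover).trans ?_
  refine (h.measure_sum_gt_le (F ∪ F') hρ.le (by positivity : 0 ≤ C * n) _).trans ?_
  rw [hcard]
  refine le_trans ?_ h2
  rw [add_mul]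
  refine add_le_add ?_ ?_
  · rw [mul_assoc]
    refine mul_le_mul_of_nonneg_left (mul_le_mul_of_nonneg_left (Real.exp_le_exp.2 ?_)
      (by linarith)) (by positivity)
    have e : -ρ₀ * (C * n) = -(r + 1) * n := by rw [← hρC]; ring
    rw [e]
    refine mul_le_mul_of_nonneg_right ?_ (by positivity)
    linarith
  · have e1 : 1 + ∫ x in Set.Iic (C * n), Real.exp (ρ * x) ∂ν ≤ 2 * Real.exp (δ' * n) := by
      have : 1 ≤ Real.exp (δ' * n) := Real.one_le_exp (by positivity)
      linarith
    have e0 : 0 ≤ 1 + ∫ x in Set.Iic (C * n), Real.exp (ρ * x) ∂ν :=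
      add_nonneg zero_le_one (integral_nonneg fun x => (Real.exp_pos _).le)
    calc _ ≤ Real.exp (-ρ * (2 * d * (n * v))) * (2 * Real.exp (δ' * n)) ^ N :=
          mul_le_mul_of_nonneg_left (pow_le_pow_left₀ e0 e1 N) (Real.exp_pos _).le
      _ = 2 ^ N * Real.exp (-r * n + δ' * N * n) := by
          rw [mul_pow, ← Real.exp_nat_mul, mul_left_comm, ← Real.exp_add]
          congr 2
          rw [hr]; ring
      _ ≤ _ := by
          refine mul_le_mul_of_nonneg_left (Real.exp_le_exp.2 ?_) (by positivity)
          have := mul_le_mul_of_nonneg_right hδN (n.cast_nonneg : (0 : ℝ) ≤ n)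
          linarith

/-- Upper bound for the upper tail. -/
theorem upper_tail_le [IsProbabilityMeasure P] (h : IIDWeights P τ ν ρ₀) {i₀ i₁ : Fin d}
    (h01 : i₀ ≠ i₁) {μ : ℝ}
    (hlim : Tendsto (fun n : ℕ => (∫ ω, passage (config τ ω) 0 (axis i₀ n) ∂P) / n) atTop (𝓝 μ))
    (hμ : 0 ≤ μ) {l : Filter ℕ} (hl : l ≤ atTop) {β : ℝ} (hβ0 : 0 < β) (hβ : UpperCost ν β l)
    {ξ : ℝ} (hξ : 0 < ξ) {a : ℝ} (ha : a < 2 * d * β * ξ) :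
    ∀ᶠ n : ℕ in l, P.real {ω | n * (μ + ξ) < passage (config τ ω) 0 (axis i₀ n)} ≤
      Real.exp (-a * n) := by
  obtain ⟨s, hs, hs0, hs1⟩ : ∃ s : ℝ,
      a < 2 * d * (β * (1 - s)) * (ξ * (1 - s)) ∧ 0 < s ∧ s < 1 := by
    have hc : Continuous fun s : ℝ => 2 * d * (β * (1 - s)) * (ξ * (1 - s)) := by fun_prop
    have h1 : ∀ᶠ s in 𝓝[>] (0 : ℝ), a < 2 * d * (β * (1 - s)) * (ξ * (1 - s)) := by
      refine nhdsWithin_le_nhds ((hc.tendsto 0).eventually_const_lt ?_)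
      simpa using ha
    have h2 : ∀ᶠ s in 𝓝[>] (0 : ℝ), s < 1 := nhdsWithin_le_nhds (Iio_mem_nhds one_pos)
    obtain ⟨s, ⟨h1, h2⟩, h3⟩ := ((h1.and h2).and self_mem_nhdsWithin).exists
    exact ⟨s, h1, h3, h2⟩
  set ρ := β * (1 - s) with hρ
  set v := ξ * (1 - s) with hv
  set δ := (2 * d * ρ * v - a) / 2 with hδ
  have hρ0 : 0 < ρ := mul_pos hβ0 (by linarith)
  have hv0 : 0 < v := mul_pos hξ (by linarith)
  have hδ0 : 0 < δ := by rw [hδ]; linarith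
  have hρβ : ρ < β := by rw [hρ]; nlinarith
  set c := 2 * d * ρ * v - δ with hc
  have hac : a < c := by rw [hc, hδ]; linarith
  obtain ⟨m, W, hm, htube⟩ := h.tube_bound h01 hlim hμ (mul_pos hξ hs0) c
  have hends : ∀ᶠ n : ℕ in l, ∀ j ∈ Finset.range m, P.real {ω | n * v <
      passage (config τ ω) 0 (axis i₁ ((j + 1) * W : ℕ)) +
      passage (config τ ω) (axis i₁ ((j + 1) * W : ℕ) + axis i₀ n) (axis i₀ n)} ≤
      Real.exp (-c * n) :=
    (Filter.eventually_all_finset _).2 fun j _ =>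
      h.end_bound h01 hl hβ ((j + 1) * W) hv0 hρ0 hρβ hδ0
  filter_upwards [hends, hl htube, hl (eventually_const_mul_exp_le (1 + m) hac)] with n h1 h2 h3
  have hcover : {ω | n * (μ + ξ) < passage (config τ ω) 0 (axis i₀ n)} ⊆
      {ω | m * n * (μ + ξ * s) < ∑ j ∈ Finset.range m, passage (config τ ω)
        (axis i₁ ((j + 1) * W : ℕ)) (axis i₁ ((j + 1) * W : ℕ) + axis i₀ n)} ∪
      ⋃ j ∈ Finset.range m, {ω | n * v <
        passage (config τ ω) 0 (axis i₁ ((j + 1) * W : ℕ)) +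
        passage (config τ ω) (axis i₁ ((j + 1) * W : ℕ) + axis i₀ n) (axis i₀ n)} := by
    intro ω hω
    by_contra hcon
    simp only [Set.mem_union, Set.mem_iUnion, Set.mem_ofPred_eq, not_or, not_exists, not_lt]
      at hcon hω
    obtain ⟨c1, c2⟩ := hcon
    have hj : ∀ j ∈ Finset.range m, passage (config τ ω) 0 (axis i₀ n) ≤
        passage (config τ ω) (axis i₁ ((j + 1) * W : ℕ))
          (axis i₁ ((j + 1) * W : ℕ) + axis i₀ n) + n * v := by
      intro j hj
      have t1 := passage_triangle (h.config_nonneg ω) 0 (axis i₁ ((j + 1) * W : ℕ)) (axis i₀ n)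
      have t2 := passage_triangle (h.config_nonneg ω) (axis i₁ ((j + 1) * W : ℕ))
        (axis i₁ ((j + 1) * W : ℕ) + axis i₀ n) (axis i₀ n)
      have t3 := c2 j hj
      linarith
    have hsum := Finset.sum_le_sum hj
    rw [Finset.sum_add_distrib, Finset.sum_const, Finset.sum_const, Finset.card_range,
      nsmul_eq_mul, nsmul_eq_mul] at hsum
    have hmR : (0 : ℝ) < m := by exact_mod_cast hm
    have g1 := mul_lt_mul_of_pos_left hω hmR
    have g2 : (m : ℝ) * (n * (μ + ξ)) = m * n * (μ + ξ * s) + m * (n * v) := by rw [hv]; ring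
    linarith
  refine (measureReal_mono hcover).trans ((measureReal_union_le _ _).trans ?_)
  refine le_trans ?_ h3
  rw [add_mul, one_mul]
  refine add_le_add h2 ((measureReal_biUnion_finset_le _ _).trans ?_)
  refine (Finset.sum_le_sum h1).trans_eq ?_
  rw [Finset.sum_const, Finset.card_range, nsmul_eq_mul]

/-- By a second moment argument, the passage time that ignores the edges at the origin is not much
smaller than `n μ` with probability bounded below. -/
lemma exists_prob_clearStar_ge [IsProbabilityMeasure P] (h : IIDWeights P τ ν ρ₀) {i₀ : Fin d}
    {μ : ℝ} (hμ : 0 ≤ μ)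
    (hmean : ∀ n : ℕ, n * μ ≤ ∫ ω, passage (config τ ω) 0 (axis i₀ n) ∂P) {ε : ℝ} (hε : 0 < ε) :
    ∃ c : ℝ, 0 < c ∧ ∀ᶠ n : ℕ in atTop,
      c ≤ P.real {ω | n * (μ - ε) < passage (clearStar (config τ ω)) 0 (axis i₀ n)} := by
  -- `D` bounds the expected cost of the edges at the origin, `V` the second moment
  set D : ℝ := ∑ b ∈ star d, ∫ ω, τ b ω ∂P with hD
  set V : ℝ := ∫ x, x ^ 2 ∂ν with hV
  have hV0 : 0 ≤ V := integral_nonneg fun x => sq_nonneg x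
  set K : ℝ := 2 * (2 * V + 2 * ε ^ 2) / ε + 1 with hK
  have hK0 : 0 < K := by positivity
  have hKV : (2 * V + 2 * ε ^ 2) / K ≤ ε / 2 := by
    rw [div_le_iff₀ hK0, hK]
    have : ε / 2 * (2 * (2 * V + 2 * ε ^ 2) / ε + 1) = 2 * V + 2 * ε ^ 2 + ε / 2 := by
      field_simp
    linarith
  refine ⟨ε / (4 * K), by positivity, ?_⟩
  have hlarge : ∀ᶠ n : ℕ in atTop, D ≤ n * (ε / 4) := by
    have : Tendsto (fun n : ℕ => (n : ℝ) * (ε / 4)) atTop atTop :=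
      tendsto_natCast_atTop_atTop.atTop_mul_const (by positivity)
    exact this.eventually_ge_atTop D
  filter_upwards [hlarge, eventually_gt_atTop 0] with n hn hn0
  have hnR : (0 : ℝ) < n := by exact_mod_cast hn0
  set X : Ω → ℝ := fun ω => passage (clearStar (config τ ω)) 0 (axis i₀ n) with hX
  have hclm : Measurable (clearStar (d := d)) := by
    refine measurable_pi_lambda _ fun b => ?_
    by_cases hb : b ∈ star d
    · simp only [clearStar, if_pos hb]; exact measurable_const
    · simp only [clearStar, if_neg hb]; exact measurable_pi_apply _
  have hXm : Measurable X := (measurable_passage _ _).comp (hclm.comp h.measurable_config)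
  have hX0 : ∀ ω, 0 ≤ X ω := fun ω => passage_nonneg (clearStar_nonneg (h.config_nonneg ω)) _ _
  have hXle : ∀ ω, X ω ≤ passage (config τ ω) 0 (axis i₀ n) := fun ω =>
    passage_mono (clearStar_nonneg (h.config_nonneg ω)) (clearStar_le (h.config_nonneg ω)) _ _
  have hXint : Integrable X P := by
    refine (h.integrable_passage 0 (axis i₀ n)).mono' hXm.aestronglyMeasurable
      (Eventually.of_forall fun ω => ?_)
    rw [Real.norm_of_nonneg (hX0 ω)]
    exact hXle ω
  have hmeanX : n * μ - D ≤ ∫ ω, X ω ∂P := by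
    have h1 : ∫ ω, passage (config τ ω) 0 (axis i₀ n) ∂P ≤
        ∫ ω, (X ω + ∑ b ∈ star d, τ b ω) ∂P :=
      integral_mono (h.integrable_passage _ _)
        (hXint.add (integrable_finsetSum _ fun b _ => h.integrable b)) fun ω =>
        passage_le_clearStar_add (h.config_nonneg ω) _
    rw [integral_add hXint (integrable_finsetSum _ fun b _ => h.integrable b),
      integral_finsetSum _ fun b _ => h.integrable b] at h1
    linarith [hmean n]
  set Q : Ω → ℝ := fun ω => n * ∑ k ∈ Finset.range n, τ (axis i₀ k, i₀) ω ^ 2 with hQ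
  have hXQ : ∀ ω, X ω ^ 2 ≤ Q ω := by
    intro ω
    have h1 := passage_le_straight (h.config_nonneg ω) 0 i₀ n
    simp only [zero_add] at h1
    have h2 : (∑ k ∈ Finset.range n, config τ ω (axis i₀ k, i₀)) ^ 2 ≤ Q ω := by
      have := sq_sum_le_card_mul_sum_sq (s := Finset.range n)
        (f := fun k : ℕ => config τ ω (axis i₀ k, i₀))
      rwa [Finset.card_range] at this
    exact (pow_le_pow_left₀ (hX0 ω) ((hXle ω).trans h1) 2).trans h2
  have hQint : Integrable Q P :=
    (integrable_finsetSum _ fun k _ => h.integrable_sq _).const_mul _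
  have hQval : ∫ ω, Q ω ∂P = n ^ 2 * V := by
    simp only [hQ]
    rw [integral_const_mul, integral_finsetSum _ fun k _ => h.integrable_sq _]
    have : ∀ b, ∫ ω, τ b ω ^ 2 ∂P = V := fun b =>
      h.integral_comp b (f := fun x => x ^ 2) (by fun_prop)
    simp only [this, Finset.sum_const, Finset.card_range, nsmul_eq_mul]
    ring
  set A : Set Ω := {ω | n * (μ - ε) < X ω} with hA
  have hAm : MeasurableSet A := measurableSet_lt measurable_const hXm
  -- `(X + n ε) 1_A ≤ n K 1_A + (X + n ε)² / (n K)`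
  have hpt : ∀ ω, X ω ≤ n * (μ - ε) + (A.indicator (fun _ => n * K) ω +
      (2 * Q ω + 2 * (n * ε) ^ 2) / (n * K)) := by
    intro ω
    have hnK : 0 < n * K := mul_pos hnR hK0
    have hsq : (X ω + n * ε) ^ 2 / (n * K) ≤ (2 * Q ω + 2 * (n * ε) ^ 2) / (n * K) := by
      refine div_le_div_of_nonneg_right ?_ hnK.le
      nlinarith [hXQ ω, sq_nonneg (X ω - n * ε)]
    by_cases hω : ω ∈ A
    · rw [Set.indicator_of_mem hω]
      have h1 : X ω + n * ε ≤ n * K + (X ω + n * ε) ^ 2 / (n * K) := by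
        rw [← sub_le_iff_le_add', le_div_iff₀ hnK]
        nlinarith [sq_nonneg (X ω + n * ε - n * K), sq_nonneg (n * K)]
      nlinarith [mul_nonneg hnR.le hμ]
    · rw [Set.indicator_of_notMem hω]
      have h1 : X ω ≤ n * (μ - ε) := not_lt.1 hω
      have : 0 ≤ (X ω + n * ε) ^ 2 / (n * K) := by positivity
      linarith
  have hIA : Integrable (A.indicator fun _ => (n : ℝ) * K) P :=
    (integrable_const _).indicator hAm
  have hIQ : Integrable (fun ω => (2 * Q ω + 2 * (n * ε) ^ 2) / (n * K)) P :=
    ((hQint.const_mul 2).add (integrable_const _)).div_const _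
  have hint := integral_mono hXint ((integrable_const _).add (hIA.add hIQ)) hpt
  have hval : ∫ ω, (n * (μ - ε) + (A.indicator (fun _ => (n : ℝ) * K) ω +
      (2 * Q ω + 2 * (n * ε) ^ 2) / (n * K))) ∂P =
      n * (μ - ε) + (P.real A * (n * K) + n * ((2 * V + 2 * ε ^ 2) / K)) := by
    have e1 := integral_add (integrable_const (μ := P) (n * (μ - ε))) (hIA.add hIQ)
    simp only [Pi.add_apply] at e1
    rw [e1, integral_add hIA hIQ,
      integral_indicator_const _ hAm, integral_div,
      integral_add (hQint.const_mul 2) (integrable_const _),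
      show ∫ ω, 2 * Q ω ∂P = 2 * ∫ ω, Q ω ∂P from integral_const_mul 2 Q, hQval]
    simp only [integral_const, probReal_univ, smul_eq_mul, one_mul]
    congr 2
    field_simp
  have h1 : n * μ - D ≤ n * (μ - ε) + (P.real A * (n * K) + n * ((2 * V + 2 * ε ^ 2) / K)) :=
    (hmeanX.trans hint).trans_eq hval
  have h2 : (n : ℝ) * ((2 * V + 2 * ε ^ 2) / K) ≤ n * (ε / 2) :=
    mul_le_mul_of_nonneg_left hKV hnR.le
  have h3 : n * (ε / 4) ≤ n * (P.real A * K) := by nlinarith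
  have h4 := le_of_mul_le_mul_left h3 hnR
  rw [div_le_iff₀ (by positivity)]
  linarith

/-- Lower bound for the upper tail: all `2d` edges at the origin are slow. -/
theorem le_upper_tail [IsProbabilityMeasure P] (h : IIDWeights P τ ν ρ₀) {i₀ : Fin d} {μ : ℝ}
    (hμ : 0 ≤ μ) (hmean : ∀ n : ℕ, n * μ ≤ ∫ ω, passage (config τ ω) 0 (axis i₀ n) ∂P)
    {l : Filter ℕ} (hl : l ≤ atTop) {β : ℝ} (hβ0 : 0 < β) (hβ : LowerCost ν β l)
    {ξ : ℝ} (hξ : 0 < ξ) {a : ℝ} (ha : 2 * d * β * ξ < a) :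
    ∀ᶠ n : ℕ in l, Real.exp (-a * n) ≤
      P.real {ω | n * (μ + ξ) < passage (config τ ω) 0 (axis i₀ n)} := by
  obtain ⟨s, hs, hs0⟩ : ∃ s : ℝ, 2 * d * ((β * (1 + s)) * (ξ * (1 + s))) < a ∧ 0 < s := by
    have hc : Continuous fun s : ℝ => 2 * d * ((β * (1 + s)) * (ξ * (1 + s))) := by fun_prop
    have h1 : ∀ᶠ s in 𝓝[>] (0 : ℝ), 2 * d * ((β * (1 + s)) * (ξ * (1 + s))) < a := by
      refine nhdsWithin_le_nhds ((hc.tendsto 0).eventually_lt_const ?_)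
      simpa [mul_assoc] using ha
    obtain ⟨s, h1, h3⟩ := (h1.and self_mem_nhdsWithin).exists
    exact ⟨s, h1, h3⟩
  set ρ := β * (1 + s) with hρ
  set v := ξ * (1 + s) with hv
  have hv0 : 0 < v := by positivity
  have hρβ : β < ρ := by rw [hρ]; nlinarith
  obtain ⟨c, hc0, hc⟩ := h.exists_prob_clearStar_ge hμ hmean (mul_pos hξ hs0)
  filter_upwards [hβ ρ hρβ v hv0, hl hc, hl (eventually_gt_atTop 0),
    hl (eventually_const_mul_exp_le (c⁻¹) hs)] with n h1 h2 hn0 h3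
  set A : Set Ω := ⋂ b ∈ star d, {ω | v * n < τ b ω} with hA
  set B : Set Ω := {ω | n * (μ - ξ * s) < passage (clearStar (config τ ω)) 0 (axis i₀ n)} with hB
  have hsub : A ∩ B ⊆ {ω | n * (μ + ξ) < passage (config τ ω) 0 (axis i₀ n)} := by
    rintro ω ⟨hωA, hωB⟩
    simp only [hA, hB, Set.mem_iInter, Set.mem_ofPred_eq] at hωA hωB ⊢
    have hne : axis i₀ (n : ℤ) ≠ 0 := by
      intro h0
      have := congrFun h0 i₀
      simp at this
      omega
    have := add_passage_clearStar_le (h.config_nonneg ω) (fun b hb => (hωA b hb).le) hne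
    have e : (n : ℝ) * (μ + ξ) = v * n + n * (μ - ξ * s) := by rw [hv]; ring
    linarith
  have hPA : P.real A = ν.real (Set.Ioi (v * n)) ^ (2 * d) := by
    have e1 := h.indep.measure_inter_preimage_eq_mul (star d)
      (sets := fun _ => Set.Ioi (v * n)) (fun _ _ => measurableSet_Ioi)
    have e2 : ∀ b, P (τ b ⁻¹' Set.Ioi (v * n)) = ν (Set.Ioi (v * n)) := fun b => by
      rw [← h.law b, Measure.map_apply (h.meas b) measurableSet_Ioi]
    simp only [e2, Finset.prod_const, card_star] at e1
    rw [Measure.real, Measure.real, ← ENNReal.toReal_pow, ← e1]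
    rfl
  have hindep : P.real (A ∩ B) = P.real A * P.real B := by
    -- `A` depends on the weights at the origin, `B` on the others
    set S : Set (Bond d) := {b | b ∈ star d} with hS
    have hind := indep_iSup_of_disjoint (fun b => (h.meas b).comap_le) h.indep
      (disjoint_compl_right (a := S))
    have hle : ∀ (T : Set (Bond d)), ∀ b ∈ T, Measurable[⨆ b ∈ T,
        MeasurableSpace.comap (τ b) inferInstance] (τ b) := fun T b hb =>
      (comap_measurable (τ b)).mono
        (le_iSup₂_of_le (f := fun b (_ : b ∈ T) => MeasurableSpace.comap (τ b) inferInstance)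
          b hb le_rfl) le_rfl
    have hAm : MeasurableSet[⨆ b ∈ S, MeasurableSpace.comap (τ b) inferInstance] A :=
      Finset.measurableSet_biInter _ fun b hb => hle S b hb measurableSet_Ioi
    have hBm : MeasurableSet[⨆ b ∈ Sᶜ, MeasurableSpace.comap (τ b) inferInstance] B := by
      have hcl : Measurable[⨆ b ∈ Sᶜ, MeasurableSpace.comap (τ b) inferInstance]
          fun ω => clearStar (config τ ω) := by
        refine @measurable_pi_lambda _ _ _ (_) _ _ fun b => ?_
        by_cases hb : b ∈ star d
        · simp only [clearStar, if_pos hb]; exact measurable_const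
        · simp only [clearStar, if_neg hb]; exact hle Sᶜ b hb
      exact (measurable_passage 0 (axis i₀ n)).comp hcl measurableSet_Ioi
    rw [Measure.real, Measure.real, Measure.real, ← ENNReal.toReal_mul]
    congr 1
    exact Indep_iff _ _ P |>.1 hind A B hAm hBm
  calc Real.exp (-a * n) = c * (c⁻¹ * Real.exp (-a * n)) := by field_simp
    _ ≤ Real.exp (-(2 * d * (ρ * v)) * n) * c := by
        rw [mul_comm c]
        exact mul_le_mul_of_nonneg_right h3 hc0.le
    _ ≤ P.real A * P.real B := by
        refine mul_le_mul ?_ h2 hc0.le measureReal_nonneg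
        rw [hPA]
        refine le_trans (le_of_eq ?_) (pow_le_pow_left₀ (Real.exp_pos _).le h1 (2 * d))
        rw [← Real.exp_nat_mul]
        congr 1
        push_cast; ring
    _ = P.real (A ∩ B) := hindep.symm
    _ ≤ _ := measureReal_mono hsub

end IIDWeights

/-! ### The weight law -/

lemma tower_strictMono : StrictMono tower :=
  strictMono_nat_of_lt_succ fun _ => Nat.lt_two_pow_self

lemma tendsto_tower_even : Tendsto (fun k => tower (2 * k)) atTop atTop :=
  tower_strictMono.tendsto_atTop.comp
    (tendsto_atTop_mono (fun k => by change k ≤ 2 * k; omega) tendsto_id)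

lemma tendsto_tower_odd : Tendsto (fun k => tower (2 * k + 1)) atTop atTop :=
  tower_strictMono.tendsto_atTop.comp
    (tendsto_atTop_mono (fun k => by change k ≤ 2 * k + 1; omega) tendsto_id)

lemma exists_tower_le_lt {x : ℝ} (hx : 0 ≤ x) :
    ∃ n : ℕ, (tower n : ℝ) ≤ x ∧ x < tower (n + 1) := by
  classical
  have hex : ∃ n, x < tower n := by
    obtain ⟨N, hN⟩ := exists_nat_gt x
    obtain ⟨n, hn⟩ := (tower_strictMono.tendsto_atTop.eventually_ge_atTop N).exists
    exact ⟨n, hN.trans_le (by exact_mod_cast hn)⟩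
  have hpos : Nat.find hex ≠ 0 := by
    intro h0
    have := Nat.find_spec hex
    rw [h0] at this
    simp only [tower, Nat.cast_zero] at this
    linarith
  obtain ⟨n, hn⟩ := Nat.exists_eq_succ_of_ne_zero hpos
  refine ⟨n, not_lt.1 (Nat.find_min hex (by omega)), ?_⟩
  have := Nat.find_spec hex
  rwa [hn] at this

lemma rawDensity_nonneg (α₁ α₂ x : ℝ) : 0 ≤ rawDensity α₁ α₂ x := by
  rw [rawDensity]; split_ifs <;> positivity

lemma measurable_rawDensity (α₁ α₂ : ℝ) : Measurable (rawDensity α₁ α₂) := by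
  have hset : ∀ f g : ℕ → ℝ, MeasurableSet {x : ℝ | ∃ n, f n ≤ x ∧ x < g n} := by
    intro f g
    have : {x : ℝ | ∃ n, f n ≤ x ∧ x < g n} = ⋃ n, Set.Ico (f n) (g n) := by
      ext x; simp
    rw [this]
    exact MeasurableSet.iUnion fun n => measurableSet_Ico
  exact Measurable.ite (hset _ _) (by fun_prop)
    (Measurable.ite (hset _ _) (by fun_prop) measurable_const)

lemma rawDensity_of_neg (α₁ α₂ : ℝ) {x : ℝ} (hx : x < 0) : rawDensity α₁ α₂ x = 0 := by
  rw [rawDensity, if_neg, if_neg]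
  all_goals
    rintro ⟨n, h1, -⟩
    have : (0 : ℝ) ≤ _ := (Nat.cast_nonneg _).trans h1
    linarith

lemma rawDensity_even {α₁ α₂ x : ℝ} {k : ℕ} (h1 : (tower (2 * k) : ℝ) ≤ x)
    (h2 : x < tower (2 * k + 1)) : rawDensity α₁ α₂ x = Real.exp (-α₂ * x) :=
  if_pos ⟨k, h1, h2⟩

lemma rawDensity_odd {α₁ α₂ x : ℝ} {k : ℕ} (h1 : (tower (2 * k + 1) : ℝ) ≤ x)
    (h2 : x < tower (2 * k + 2)) : rawDensity α₁ α₂ x = Real.exp (-α₁ * x) := by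
  rw [rawDensity, if_neg, if_pos ⟨k, h1, h2⟩]
  rintro ⟨n, h3, h4⟩
  have e1 : (tower (2 * n) : ℝ) < tower (2 * k + 2) := h3.trans_lt h2
  have e2 : (tower (2 * k + 1) : ℝ) < tower (2 * n + 1) := h1.trans_lt h4
  have e1' := tower_strictMono.lt_iff_lt.1
    (by exact_mod_cast e1 : tower (2 * n) < tower (2 * k + 2))
  have e2' := tower_strictMono.lt_iff_lt.1
    (by exact_mod_cast e2 : tower (2 * k + 1) < tower (2 * n + 1))
  omega

lemma rawDensity_eq_or {α₁ α₂ x : ℝ} (hx : 0 ≤ x) :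
    rawDensity α₁ α₂ x = Real.exp (-α₂ * x) ∨ rawDensity α₁ α₂ x = Real.exp (-α₁ * x) := by
  obtain ⟨n, h1, h2⟩ := exists_tower_le_lt hx
  obtain ⟨k, rfl | rfl⟩ := Nat.even_or_odd' n
  · exact Or.inl (rawDensity_even h1 h2)
  · exact Or.inr (rawDensity_odd h1 h2)

lemma rawDensity_le {α₁ α₂ x : ℝ} (hα : α₁ ≤ α₂) (hx : 0 ≤ x) :
    rawDensity α₁ α₂ x ≤ Real.exp (-α₁ * x) := by
  rcases rawDensity_eq_or (α₁ := α₁) (α₂ := α₂) hx with h | h <;> rw [h]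
  exact Real.exp_le_exp.2 (by nlinarith)

lemma le_rawDensity {α₁ α₂ x : ℝ} (hα : α₁ ≤ α₂) (hx : 0 ≤ x) :
    Real.exp (-α₂ * x) ≤ rawDensity α₁ α₂ x := by
  rcases rawDensity_eq_or (α₁ := α₁) (α₂ := α₂) hx with h | h <;> rw [h]
  exact Real.exp_le_exp.2 (by nlinarith)

lemma normConst_nonneg (α₁ α₂ : ℝ) : 0 ≤ normConst α₁ α₂ :=
  inv_nonneg.2 (integral_nonneg fun x => rawDensity_nonneg α₁ α₂ x)

lemma measurable_density (α₁ α₂ : ℝ) :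
    Measurable fun x => ENNReal.ofReal (normConst α₁ α₂ * rawDensity α₁ α₂ x) :=
  ((measurable_rawDensity α₁ α₂).const_mul _).ennreal_ofReal

lemma toReal_density (α₁ α₂ x : ℝ) :
    (ENNReal.ofReal (normConst α₁ α₂ * rawDensity α₁ α₂ x)).toReal =
      normConst α₁ α₂ * rawDensity α₁ α₂ x :=
  ENNReal.toReal_ofReal (mul_nonneg (normConst_nonneg _ _) (rawDensity_nonneg _ _ _))

lemma normConst_pos (α₁ α₂ : ℝ) [IsProbabilityMeasure (weightLaw α₁ α₂)] :
    0 < normConst α₁ α₂ := by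
  refine lt_of_le_of_ne (normConst_nonneg _ _) fun h0 => ?_
  have h : weightLaw α₁ α₂ = 0 := by
    rw [weightLaw, ← h0]
    simp
  exact IsProbabilityMeasure.ne_zero (weightLaw α₁ α₂) h

lemma integrableOn_exp_Ici {b : ℝ} (hb : 0 < b) :
    IntegrableOn (fun x : ℝ => Real.exp (-b * x)) (Set.Ici 0) :=
  (integrableOn_Ici_iff_integrableOn_Ioi (by simp)).2 (exp_neg_integrableOn_Ioi 0 hb)

lemma integrable_exp_weightLaw {α₁ α₂ ρ : ℝ} (hα : α₁ ≤ α₂) (hρ : ρ < α₁) :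
    Integrable (fun x : ℝ => Real.exp (ρ * x)) (weightLaw α₁ α₂) := by
  rw [weightLaw, integrable_withDensity_iff (measurable_density _ _)
    (Eventually.of_forall fun x => ENNReal.ofReal_lt_top)]
  simp only [toReal_density]
  have hI := (((integrableOn_exp_Ici (sub_pos.2 hρ)).integrable_indicator
    measurableSet_Ici).const_mul (normConst α₁ α₂))
  refine hI.mono' (Measurable.aestronglyMeasurable ?_) (Eventually.of_forall fun x => ?_)
  · exact (by fun_prop : Measurable fun x : ℝ => Real.exp (ρ * x)).mul
      ((measurable_rawDensity α₁ α₂).const_mul _)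
  have hc := normConst_nonneg α₁ α₂
  rw [Real.norm_of_nonneg (mul_nonneg (Real.exp_pos _).le
    (mul_nonneg hc (rawDensity_nonneg _ _ _)))]
  by_cases hx : 0 ≤ x
  · rw [Set.indicator_of_mem (Set.mem_Ici.2 hx), mul_left_comm]
    refine mul_le_mul_of_nonneg_left ?_ hc
    calc Real.exp (ρ * x) * rawDensity α₁ α₂ x ≤ Real.exp (ρ * x) * Real.exp (-α₁ * x) :=
          mul_le_mul_of_nonneg_left (rawDensity_le hα hx) (Real.exp_pos _).le
      _ = _ := by rw [← Real.exp_add]; congr 1; ring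
  · rw [rawDensity_of_neg _ _ (not_le.1 hx)]
    simp only [mul_zero]
    exact mul_nonneg hc (Set.indicator_nonneg (fun _ _ => (Real.exp_pos _).le) _)

/-- `C m² + 1` is eventually smaller than `2 ^ m`: the square of a tower number is far below the
next tower number. -/
lemma eventually_sq_lt_two_pow (C : ℝ) : ∀ᶠ m : ℕ in atTop, C * (m : ℝ) ^ 2 + 1 < 2 ^ m := by
  have h := tendsto_pow_const_div_const_pow_of_one_lt 2 (r := (2 : ℝ)) one_lt_two
  have hpos : (0 : ℝ) < (|C| + 2)⁻¹ := by positivity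
  filter_upwards [h.eventually_lt_const hpos, eventually_ge_atTop 1] with m hm hm1
  have h2 : (0 : ℝ) < 2 ^ m := by positivity
  rw [div_lt_iff₀ h2, inv_mul_eq_div, lt_div_iff₀ (by positivity)] at hm
  have h1 : (1 : ℝ) ≤ m := by exact_mod_cast hm1
  have h3 : C * (m : ℝ) ^ 2 ≤ |C| * (m : ℝ) ^ 2 :=
    mul_le_mul_of_nonneg_right (le_abs_self C) (by positivity)
  nlinarith

lemma upperCost_atTop {α₁ α₂ : ℝ} (hα : α₁ ≤ α₂) :
    UpperCost (weightLaw α₁ α₂) α₁ atTop := by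
  intro ρ _ hρα C _ δ hδ
  have hI := integrable_exp_weightLaw (α₁ := α₁) (α₂ := α₂) hα hρα
  have ht : Tendsto (fun n : ℕ => Real.exp (δ * n)) atTop atTop :=
    Real.tendsto_exp_atTop.comp (tendsto_natCast_atTop_atTop.const_mul_atTop hδ)
  filter_upwards [ht.eventually_ge_atTop (∫ x, Real.exp (ρ * x) ∂weightLaw α₁ α₂)] with n hn
  exact (setIntegral_le_integral hI (Eventually.of_forall fun x => (Real.exp_pos _).le)).trans hn

/-- At the square of an even tower number the weight law looks exponential with parameter `α₂`: the
smaller weights, of rate `α₁`, only contribute a subexponential factor. -/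
lemma upperCost_even {α₁ α₂ : ℝ} (hα : α₁ ≤ α₂) :
    UpperCost (weightLaw α₁ α₂) α₂ (map (fun k => tower (2 * k) ^ 2) atTop) := by
  intro ρ _ hρα C _ δ hδ
  rw [eventually_map]
  set J : ℝ := ∫ x in Set.Ici (0 : ℝ), Real.exp (-(α₂ - ρ) * x) with hJ
  have hc := normConst_nonneg α₁ α₂
  have hgrow : ∀ᶠ m : ℕ in atTop,
      normConst α₁ α₂ * J * Real.exp ((α₂ - α₁) * m) ≤ Real.exp (δ * (m : ℝ) ^ 2) := by
    have h1 : Tendsto (fun m : ℕ => (m : ℝ) * (δ * m - (α₂ - α₁))) atTop atTop :=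
      tendsto_natCast_atTop_atTop.atTop_mul_atTop₀ (tendsto_atTop_add_const_right _ _
        (tendsto_natCast_atTop_atTop.const_mul_atTop hδ))
    filter_upwards [(Real.tendsto_exp_atTop.comp h1).eventually_ge_atTop (normConst α₁ α₂ * J)]
      with m hm
    refine (mul_le_mul_of_nonneg_right hm (Real.exp_pos _).le).trans_eq ?_
    rw [Function.comp_apply, ← Real.exp_add]
    congr 1; ring
  filter_upwards [tendsto_tower_even.eventually (eventually_sq_lt_two_pow C),
    tendsto_tower_even.eventually hgrow] with k h1 h2
  set t : ℕ := tower (2 * k) with ht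
  have hA : C * ((t ^ 2 : ℕ) : ℝ) < tower (2 * k + 1) := by
    have : (tower (2 * k + 1) : ℝ) = 2 ^ t := by rw [tower]; push_cast; rfl
    rw [this]; push_cast; linarith
  have hI := ((integrableOn_exp_Ici (sub_pos.2 hρα)).integrable_indicator
    measurableSet_Ici).const_mul (normConst α₁ α₂ * Real.exp ((α₂ - α₁) * t))
  rw [weightLaw, setIntegral_withDensity_eq_setIntegral_toReal_smul (measurable_density _ _)
    (Eventually.of_forall fun x => ENNReal.ofReal_lt_top) _ measurableSet_Iic,
    ← integral_indicator measurableSet_Iic]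
  calc _ ≤ ∫ x, normConst α₁ α₂ * Real.exp ((α₂ - α₁) * t) *
        (Set.Ici (0 : ℝ)).indicator (fun x => Real.exp (-(α₂ - ρ) * x)) x := by
        refine integral_mono_of_nonneg (Eventually.of_forall fun x => ?_) hI
          (Eventually.of_forall fun x => ?_)
        · refine Set.indicator_nonneg (fun x _ => ?_) x
          exact mul_nonneg ENNReal.toReal_nonneg (Real.exp_pos _).le
        · have hrhs : 0 ≤ normConst α₁ α₂ * Real.exp ((α₂ - α₁) * t) *
              (Set.Ici (0 : ℝ)).indicator (fun x => Real.exp (-(α₂ - ρ) * x)) x :=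
            mul_nonneg (mul_nonneg hc (Real.exp_pos _).le)
              (Set.indicator_nonneg (fun _ _ => (Real.exp_pos _).le) _)
          by_cases hxA : x ≤ C * ((t ^ 2 : ℕ) : ℝ)
          · simp only [Set.indicator_of_mem (Set.mem_Iic.2 hxA), toReal_density, smul_eq_mul]
            by_cases hx : 0 ≤ x
            · rw [Set.indicator_of_mem (Set.mem_Ici.2 hx), mul_assoc, mul_assoc]
              refine mul_le_mul_of_nonneg_left ?_ hc
              have hraw : rawDensity α₁ α₂ x ≤
                  Real.exp ((α₂ - α₁) * t) * Real.exp (-α₂ * x) := by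
                rw [← Real.exp_add]
                rcases lt_or_ge x t with hxt | hxt
                · refine (rawDensity_le hα hx).trans (Real.exp_le_exp.2 ?_)
                  nlinarith
                · rw [rawDensity_even hxt (hxA.trans_lt hA)]
                  refine Real.exp_le_exp.2 ?_
                  have : 0 ≤ (α₂ - α₁) * t := mul_nonneg (by linarith) (Nat.cast_nonneg _)
                  linarith
              refine (mul_le_mul_of_nonneg_right hraw (Real.exp_pos _).le).trans_eq ?_
              rw [mul_assoc, ← Real.exp_add]
              congr 2; ring
            · rw [rawDensity_of_neg _ _ (not_le.1 hx)]
              simpa using hrhs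
          · rw [Set.indicator_of_notMem (fun h => hxA (Set.mem_Iic.1 h))]
            exact hrhs
    _ = normConst α₁ α₂ * J * Real.exp ((α₂ - α₁) * t) := by
        rw [integral_const_mul, integral_indicator measurableSet_Ici]
        ring
    _ ≤ _ := by
        refine h2.trans_eq ?_
        push_cast; rfl

lemma le_weightLaw_Ioi {α₁ α₂ : ℝ} [IsProbabilityMeasure (weightLaw α₁ α₂)] {x c : ℝ}
    (hc : ∀ y ∈ Set.Ioc x (x + 1), c ≤ rawDensity α₁ α₂ y) :
    normConst α₁ α₂ * c ≤ (weightLaw α₁ α₂).real (Set.Ioi x) := by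
  refine le_trans ?_ (measureReal_mono (μ := weightLaw α₁ α₂)
    (show Set.Ioc x (x + 1) ⊆ Set.Ioi x from Set.Ioc_subset_Ioi_self))
  rw [Measure.real, ← ENNReal.ofReal_le_iff_le_toReal (measure_ne_top _ _), weightLaw,
    withDensity_apply _ measurableSet_Ioc]
  have h1 : ∫⁻ _y in Set.Ioc x (x + 1), ENNReal.ofReal (normConst α₁ α₂ * c) =
      ENNReal.ofReal (normConst α₁ α₂ * c) := by
    simp
  rw [← h1]
  exact setLIntegral_mono (measurable_density _ _) fun y hy =>
    ENNReal.ofReal_le_ofReal (mul_le_mul_of_nonneg_left (hc y hy) (normConst_nonneg _ _))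

lemma lowerCost_of_density {α₁ α₂ β : ℝ} [IsProbabilityMeasure (weightLaw α₁ α₂)]
    {l : Filter ℕ} (hl : l ≤ atTop)
    (hβ : ∀ C : ℝ, 0 < C → ∀ᶠ n : ℕ in l, ∀ y ∈ Set.Ioc (C * n) (C * n + 1),
      Real.exp (-β * y) ≤ rawDensity α₁ α₂ y) (hβ0 : 0 < β) :
    LowerCost (weightLaw α₁ α₂) β l := by
  intro ρ hρ C hC
  have hc := normConst_pos α₁ α₂
  have hfin := eventually_const_mul_exp_le ((normConst α₁ α₂)⁻¹ * Real.exp β)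
    (a := β * C) (b := ρ * C) (mul_lt_mul_of_pos_right hρ hC)
  filter_upwards [hβ C hC, hl hfin] with n h1 h2
  refine le_trans ?_ (le_weightLaw_Ioi (c := Real.exp (-β * (C * n + 1))) fun y hy =>
    le_trans (Real.exp_le_exp.2 ?_) (h1 y hy))
  · have e1 : Real.exp (-β * (C * n + 1)) = Real.exp (-(β * C) * n) * Real.exp (-β) := by
      rw [← Real.exp_add]; congr 1; ring
    have e2 : Real.exp (-ρ * (C * n)) = Real.exp (-(ρ * C) * n) := by congr 1; ring
    have e3 : Real.exp β * Real.exp (-β) = 1 := by rw [← Real.exp_add]; simp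
    rw [e1, e2]
    calc Real.exp (-(ρ * C) * n)
        = normConst α₁ α₂ * (((normConst α₁ α₂)⁻¹ * Real.exp β * Real.exp (-(ρ * C) * n)) *
            Real.exp (-β)) := by
          rw [show normConst α₁ α₂ * (((normConst α₁ α₂)⁻¹ * Real.exp β *
            Real.exp (-(ρ * C) * n)) * Real.exp (-β)) = (normConst α₁ α₂ * (normConst α₁ α₂)⁻¹) *
            (Real.exp β * Real.exp (-β)) * Real.exp (-(ρ * C) * n) by ring, e3,
            mul_inv_cancel₀ hc.ne']
          ring
      _ ≤ _ := mul_le_mul_of_nonneg_left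
          (mul_le_mul_of_nonneg_right h2 (Real.exp_pos _).le) hc.le
  · have := hy.2
    nlinarith

lemma lowerCost_atTop {α₁ α₂ : ℝ} (hα : α₁ ≤ α₂) (h2 : 0 < α₂)
    [IsProbabilityMeasure (weightLaw α₁ α₂)] : LowerCost (weightLaw α₁ α₂) α₂ atTop :=
  lowerCost_of_density le_rfl (fun C hC => Eventually.of_forall fun n y hy =>
    le_rawDensity hα (le_trans (by positivity) hy.1.le)) h2

/-- At the square of an odd tower number the weight law looks exponential with parameter `α₁`. -/
lemma lowerCost_odd {α₁ α₂ : ℝ} (h1 : 0 < α₁) [IsProbabilityMeasure (weightLaw α₁ α₂)] :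
    LowerCost (weightLaw α₁ α₂) α₁ (map (fun k => tower (2 * k + 1) ^ 2) atTop) := by
  refine lowerCost_of_density
    ((tendsto_pow_atTop two_ne_zero).comp tendsto_tower_odd) (fun C hC => ?_) h1
  rw [eventually_map]
  have hlow : ∀ᶠ m : ℕ in atTop, (m : ℝ) ≤ C * (m : ℝ) ^ 2 := by
    have h2 : Tendsto (fun m : ℕ => C * (m : ℝ)) atTop atTop :=
      tendsto_natCast_atTop_atTop.const_mul_atTop hC
    filter_upwards [h2.eventually_ge_atTop 1] with m hm
    nlinarith [(Nat.cast_nonneg m : (0 : ℝ) ≤ m)]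
  filter_upwards [tendsto_tower_odd.eventually (eventually_sq_lt_two_pow C),
    tendsto_tower_odd.eventually hlow] with k g1 g2 y hy
  have e : (tower (2 * k + 2) : ℝ) = 2 ^ tower (2 * k + 1) := by rw [tower]; push_cast; rfl
  have hy1 := hy.1
  have hy2 := hy.2
  push_cast at hy1 hy2
  exact (rawDensity_odd (g2.trans hy1.le) (by rw [e]; linarith)).ge

/-! ### Translation to the extended reals -/

lemma passageTime_eq_passage (t : Edge d → ℝ) (x y : Fin d → ℝ) :
    passageTime t x y = passage (fun b => t (bondEdge b)) (floorPt x) (floorPt y) := by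
  have h : (fun b : Bond d => t (bondEdge b)) ∘ bondEquiv.symm = t := by
    funext e
    exact congrArg t (bondEquiv.apply_symm_apply e)
  rw [passageTime, passage]
  simp only [walkTime, h]

lemma floorPt_zero : floorPt (0 : Fin d → ℝ) = 0 := by
  funext i; simp [floorPt]

lemma floorPt_smul_e₁ {i₀ : Fin d} (hi : (i₀ : ℕ) = 0) (t : ℝ) :
    floorPt (t • e₁ d) = axis i₀ ⌊t⌋ := by
  funext i
  by_cases h : i = i₀
  · subst h; simp [floorPt, e₁, hi]
  · have h' : (i : ℕ) ≠ 0 := fun h0 => h (Fin.ext (h0.trans hi.symm))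
    simp [floorPt, e₁, h, h']

lemma weightLaw_Iio_zero (α₁ α₂ : ℝ) : weightLaw α₁ α₂ (Set.Iio 0) = 0 := by
  rw [weightLaw, withDensity_apply _ measurableSet_Iio]
  refine (setLIntegral_congr_fun measurableSet_Iio fun x hx => ?_).trans
    (lintegral_zero (μ := volume.restrict (Set.Iio 0)))
  simp [rawDensity_of_neg α₁ α₂ hx]

/-- The positive parts of the weights. They agree almost surely with the weights. -/
def posWeights (τ : Edge d → Ω → ℝ) (b : Bond d) (ω : Ω) : ℝ := max (τ (bondEdge b) ω) 0

lemma ae_nonneg_of_law {τ : Edge d → Ω → ℝ} {α₁ α₂ : ℝ} (hmeas : ∀ e, Measurable (τ e))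
    (hlaw : ∀ e, P.map (τ e) = weightLaw α₁ α₂) : ∀ᵐ ω ∂P, ∀ e, 0 ≤ τ e ω := by
  have : Countable (Edge d) := (bondEquiv (d := d)).symm.injective.countable
  rw [ae_all_iff]
  intro e
  have h := weightLaw_Iio_zero α₁ α₂
  rw [← hlaw e, Measure.map_apply (hmeas e) measurableSet_Iio] at h
  rw [ae_iff]
  refine measure_mono_null (fun ω hω => ?_) h
  exact not_le.1 hω

lemma ae_passageTime_eq {τ : Edge d → Ω → ℝ} {α₁ α₂ : ℝ} (hmeas : ∀ e, Measurable (τ e))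
    (hlaw : ∀ e, P.map (τ e) = weightLaw α₁ α₂) {i₀ : Fin d} (hi : (i₀ : ℕ) = 0) (t : ℝ) :
    (fun ω => passageTime (fun e => τ e ω) 0 (t • e₁ d)) =ᵐ[P]
      fun ω => passage (config (posWeights τ) ω) 0 (axis i₀ ⌊t⌋) := by
  filter_upwards [ae_nonneg_of_law hmeas hlaw] with ω hω
  rw [passageTime_eq_passage, floorPt_zero, floorPt_smul_e₁ hi]
  congr 1
  funext b
  exact (max_eq_left (hω _)).symm

lemma iidWeights_posWeights {τ : Edge d → Ω → ℝ} {α₁ α₂ : ℝ} (hα₁ : 0 < α₁) (hα : α₁ < α₂)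
    (hmeas : ∀ e, Measurable (τ e)) (hindep : iIndepFun τ P)
    (hlaw : ∀ e, P.map (τ e) = weightLaw α₁ α₂) :
    IIDWeights P (posWeights τ) (weightLaw α₁ α₂) (α₁ / 2) where
  meas b := (hmeas _).max measurable_const
  indep := (hindep.precomp bondEdge_injective).comp (fun _ x => max x 0)
    fun _ => measurable_id.max measurable_const
  law b := by
    rw [← hlaw (bondEdge b)]
    refine Measure.map_congr ?_
    filter_upwards [ae_nonneg_of_law hmeas hlaw] with ω hω
    exact max_eq_left (hω _)
  nonneg b ω := le_max_right _ _
  rate_pos := by positivity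
  exp_int := integrable_exp_weightLaw hα.le (by linarith)

/-- Limits of `u n / n` along the integers pass to real times. -/
lemma tendsto_inv_mul_floor {u : ℤ → ℝ} {μ : ℝ}
    (h : Tendsto (fun n : ℕ => u n / n) atTop (𝓝 μ)) :
    Tendsto (fun t : ℝ => t⁻¹ * u ⌊t⌋) atTop (𝓝 μ) := by
  have h1 := (h.comp (tendsto_nat_floor_atTop (α := ℝ))).mul (tendsto_nat_floor_div_atTop (R := ℝ))
  rw [mul_one] at h1
  refine h1.congr' ?_
  filter_upwards [eventually_ge_atTop (1 : ℝ)] with t ht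
  have h2 : (⌊t⌋ : ℤ) = (⌊t⌋₊ : ℤ) := (Int.natCast_floor_eq_floor (by linarith)).symm
  have h3 : (⌊t⌋₊ : ℝ) ≠ 0 := by
    have : 1 ≤ ⌊t⌋₊ := Nat.le_floor (by exact_mod_cast ht)
    positivity
  rw [h2, Function.comp_apply]
  field_simp

lemma inv_mul_log_le {n : ℕ} (hn : 0 < n) [IsProbabilityMeasure P] {A : Set Ω} {a : ℝ}
    (h : P.real A ≤ Real.exp (-a * n)) :
    (((1 : ℝ) / n : ℝ) : EReal) * ENNReal.log (P A) ≤ ((-a : ℝ) : EReal) := by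
  have hn' : (0 : ℝ) < n := by exact_mod_cast hn
  have h1 : P A ≤ ENNReal.ofReal (Real.exp (-a * n)) := by
    rw [← ofReal_measureReal (measure_ne_top P A)]
    exact ENNReal.ofReal_le_ofReal h
  have h2 := ENNReal.log_monotone h1
  rw [ENNReal.log_ofReal_of_pos (Real.exp_pos _), Real.log_exp] at h2
  refine (mul_le_mul_of_nonneg_left h2 (EReal.coe_nonneg.2 (by positivity))).trans_eq ?_
  rw [← EReal.coe_mul]
  congr 1
  field_simp

lemma le_inv_mul_log {n : ℕ} (hn : 0 < n) [IsProbabilityMeasure P] {A : Set Ω} {a : ℝ}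
    (h : Real.exp (-a * n) ≤ P.real A) :
    ((-a : ℝ) : EReal) ≤ (((1 : ℝ) / n : ℝ) : EReal) * ENNReal.log (P A) := by
  have hn' : (0 : ℝ) < n := by exact_mod_cast hn
  have h1 : ENNReal.ofReal (Real.exp (-a * n)) ≤ P A := by
    rw [← ofReal_measureReal (measure_ne_top P A)]
    exact ENNReal.ofReal_le_ofReal h
  have h2 := ENNReal.log_monotone h1
  rw [ENNReal.log_ofReal_of_pos (Real.exp_pos _), Real.log_exp] at h2
  refine le_trans (le_of_eq ?_) (mul_le_mul_of_nonneg_left h2 (EReal.coe_nonneg.2 (by positivity)))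
  rw [← EReal.coe_mul]
  congr 1
  field_simp

end FPP

end

theorem theorem2 (d : ℕ) (hd : 2 ≤ d) (α₁ α₂ : ℝ) (hα₁ : 0 < α₁) (hα : α₁ < α₂)
    {Ω : Type*} [MeasurableSpace Ω] (P : Measure Ω) [IsProbabilityMeasure P]
    (τ : FPP.Edge d → Ω → ℝ) (hmeas : ∀ e, Measurable (τ e)) (hindep : iIndepFun τ P)
    (hlaw : ∀ e, P.map (τ e) = FPP.weightLaw α₁ α₂) :
    -- the weight law has a finite exponential moment
    (∀ ρ : ℝ, ρ < α₁ → Integrable (fun x : ℝ => Real.exp (ρ * x)) (FPP.weightLaw α₁ α₂)) ∧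
    -- the expectations and the limit that define the time constant exist
    (∀ t : ℝ, Integrable (fun ω => FPP.passageTime (fun e => τ e ω) 0 (t • FPP.e₁ d)) P) ∧
    Tendsto (fun t : ℝ => t⁻¹ * ∫ ω, FPP.passageTime (fun e => τ e ω) 0 (t • FPP.e₁ d) ∂P)
      atTop (𝓝 (FPP.timeConstant P τ (FPP.e₁ d))) ∧
    ∀ ξ : ℝ, 0 < ξ →
      limsup (FPP.logUpperTail P τ ξ) atTop = ((-2 * d * α₁ * ξ : ℝ) : EReal) ∧
      liminf (FPP.logUpperTail P τ ξ) atTop = ((-2 * d * α₂ * ξ : ℝ) : EReal) ∧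
      ⊥ < liminf (FPP.logUpperTail P τ ξ) atTop ∧
      liminf (FPP.logUpperTail P τ ξ) atTop < limsup (FPP.logUpperTail P τ ξ) atTop ∧
      limsup (FPP.logUpperTail P τ ξ) atTop < 0 ∧
      ¬ ∃ l : EReal, Tendsto (FPP.logUpperTail P τ ξ) atTop (𝓝 l) := by
  open FPP in
  have hα₂ : 0 < α₂ := hα₁.trans hα
  set i₀ : Fin d := ⟨0, by omega⟩ with hi₀
  set i₁ : Fin d := ⟨1, by omega⟩ with hi₁
  have h01 : i₀ ≠ i₁ := fun h => by simp [hi₀, hi₁] at h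
  have hiid := iidWeights_posWeights hα₁ hα hmeas hindep hlaw
  have : IsProbabilityMeasure (weightLaw α₁ α₂) := by
    rw [← hlaw (bondEdge (0, i₀))]
    exact Measure.isProbabilityMeasure_map (hmeas _).aemeasurable
  have hae := fun t => ae_passageTime_eq hmeas hlaw (i₀ := i₀) rfl t
  obtain ⟨μ, hμ0, hμ, hmean⟩ := hiid.exists_rate i₀
  have hlim : Tendsto (fun t : ℝ => t⁻¹ * ∫ ω, passageTime (fun e => τ e ω) 0 (t • e₁ d) ∂P)
      atTop (𝓝 μ) := by
    have := tendsto_inv_mul_floor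
      (u := fun k : ℤ => ∫ ω, passage (config (posWeights τ) ω) 0 (axis i₀ k) ∂P) hμ
    refine this.congr fun t => ?_
    rw [integral_congr_ae (hae t)]
  have hconst : timeConstant P τ (e₁ d) = μ := hlim.limUnder_eq
  refine ⟨fun ρ hρ => integrable_exp_weightLaw hα.le hρ,
    fun t => (hiid.integrable_passage _ _).congr (hae t).symm, by rw [hconst]; exact hlim, ?_⟩
  intro ξ hξ
  have hdpos : (0 : ℝ) < d := by
    have : 0 < d := by omega
    exact_mod_cast this
  have hev : ∀ n : ℕ, logUpperTail P τ ξ n = (((1 : ℝ) / n : ℝ) : EReal) * ENNReal.log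
      (P {ω | n * (μ + ξ) < passage (config (posWeights τ) ω) 0 (axis i₀ n)}) := by
    intro n
    rw [logUpperTail, hconst]
    congr 2
    refine measure_congr ?_
    filter_upwards [hae n] with ω hω
    rw [Int.floor_natCast] at hω
    refine propext ?_
    change _ < _ ↔ _ < _
    rw [hω]
  have hupper : ∀ (β : ℝ), 0 < β → ∀ l : Filter ℕ, l ≤ atTop → UpperCost (weightLaw α₁ α₂) β l →
      ∀ z : ℝ, -2 * d * β * ξ < z → ∀ᶠ n in l, logUpperTail P τ ξ n ≤ (z : EReal) := by
    intro β hβ0 l hl hβ z hz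
    filter_upwards [hiid.upper_tail_le h01 hμ hμ0 hl hβ0 hβ hξ (a := -z) (by linarith),
      hl (eventually_gt_atTop 0)] with n h1 h2
    rw [hev]
    simpa using inv_mul_log_le h2 h1
  have hlower : ∀ (β : ℝ), 0 < β → ∀ l : Filter ℕ, l ≤ atTop → LowerCost (weightLaw α₁ α₂) β l →
      ∀ z : ℝ, z < -2 * d * β * ξ → ∀ᶠ n in l, (z : EReal) ≤ logUpperTail P τ ξ n := by
    intro β hβ0 l hl hβ z hz
    filter_upwards [hiid.le_upper_tail hμ0 hmean hl hβ0 hβ hξ (a := -z) (by linarith),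
      hl (eventually_gt_atTop 0)] with n h1 h2
    rw [hev]
    simpa using le_inv_mul_log h2 h1
  have heven : map (fun k => tower (2 * k) ^ 2) atTop ≤ (atTop : Filter ℕ) :=
    (tendsto_pow_atTop two_ne_zero).comp tendsto_tower_even
  have hodd : map (fun k => tower (2 * k + 1) ^ 2) atTop ≤ (atTop : Filter ℕ) :=
    (tendsto_pow_atTop two_ne_zero).comp tendsto_tower_odd
  have hsup : limsup (logUpperTail P τ ξ) atTop = ((-2 * d * α₁ * ξ : ℝ) : EReal) := by
    refine le_antisymm (EReal.le_of_forall_lt_iff_le.1 fun z hz => ?_)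
      (EReal.ge_of_forall_gt_iff_ge.1 fun z hz => ?_)
    · exact limsup_le_of_le (h := hupper α₁ hα₁ atTop le_rfl (upperCost_atTop hα.le) z
        (EReal.coe_lt_coe_iff.1 hz))
    · exact le_limsup_of_frequently_le ((hlower α₁ hα₁ _ hodd (lowerCost_odd hα₁) z
        (EReal.coe_lt_coe_iff.1 hz)).frequently.filter_mono hodd)
  have hinf : liminf (logUpperTail P τ ξ) atTop = ((-2 * d * α₂ * ξ : ℝ) : EReal) := by
    refine le_antisymm (EReal.le_of_forall_lt_iff_le.1 fun z hz => ?_)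
      (EReal.ge_of_forall_gt_iff_ge.1 fun z hz => ?_)
    · exact liminf_le_of_frequently_le ((hupper α₂ hα₂ _ heven (upperCost_even hα.le) z
        (EReal.coe_lt_coe_iff.1 hz)).frequently.filter_mono heven)
    · exact le_liminf_of_le (h := hlower α₂ hα₂ atTop le_rfl (lowerCost_atTop hα.le hα₂) z
        (EReal.coe_lt_coe_iff.1 hz))
  have hlt : -2 * d * α₂ * ξ < -2 * d * α₁ * ξ := by
    have := mul_lt_mul_of_pos_left hα (mul_pos hdpos hξ)
    nlinarith
  refine ⟨hsup, hinf, ?_, ?_, ?_, ?_⟩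
  · rw [hinf]; exact EReal.bot_lt_coe _
  · rw [hinf, hsup]; exact EReal.coe_lt_coe_iff.2 hlt
  · rw [hsup]
    have : -2 * d * α₁ * ξ < 0 := by
      have : 0 < d * α₁ * ξ := by positivity
      linarith
    exact_mod_cast this
  · rintro ⟨l, hl⟩
    have h1 := hl.limsup_eq
    have h2 := hl.liminf_eq
    rw [hsup] at h1
    rw [hinf] at h2
    exact hlt.ne (EReal.coe_injective (h2.trans h1.symm))
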